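/- There is a universal constant $c_0>0$ such that for all constants $c_0\le c_1\le c_2$ there is a constant $C>0$, depending only on $c_1$ and $c_2$, with the following property. Let $n\ge 1$ and $d\ge 2$ be integers, let $R>0$, and let $x_1,\dots,x_n$ be i.i.d. random vectors in $\mathbb{R}^d$ with $\mathbb{E}\,x_i=0$ and $\mathbb{E}(v^Tx_i)^4\le R$ for every $v\in\mathbb{R}^d$ with $\|v\|_2=1$. Put $\Sigma=\mathbb{E}(x_ix_i^T)$. For $\tau>0$ let $\tilde x_i=(\min\{\|x_i\|_4,\tau\}/\|x_i\|_4)\,x_i$ (with $\tilde x_i=0$ if $x_i=0$), where $\|x\|_4=(\sum_{j=1}^d |x_j|^4)^{1/4}$, and let $$\tilde\Sigma_n(\tau)=\frac1n\sum_{i=1}^n \tilde x_i\tilde x_i^T .$$ Then for every $\delta>0$ and every $\tau$ with $$c_1\Big(\frac{nR}{\delta\log d}\Big)^{1/4}\le\tau\le c_2\Big(\frac{nR}{\delta\log d}\Big)^{1/4}$$ one has $$P\left(\big\|\tilde\Sigma_n(\tau)-\Sigma\big\|_{\mathrm{op}}\ge\sqrt{\frac{\delta R\,d\log d}{n}}\right)\le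 d^{\,1-C\delta},$$ where $\|\cdot\|_{\mathrm{op}}$ is the operator norm of a matrix with respect to the Euclidean norm. -/

import Mathlib

open MeasureTheory ProbabilityTheory

noncomputable section

/-- The `ℓ₄` norm of a vector of `ℝ^d`. -/
def ellFourNorm {d : ℕ} (x : EuclideanSpace ℝ (Fin d)) : ℝ :=
  (∑ j, |x j| ^ 4) ^ ((1 : ℝ) / 4)

/-- Shrinkage in `ℓ₄` norm at level `τ`: the vector `(‖x‖₄ ∧ τ) x / ‖x‖₄`
(equal to `0` at `x = 0`). -/
def ellFourShrink {d : ℕ} (τ : ℝ) (x : EuclideanSpace ℝ (Fin d)) : EuclideanSpace ℝ (Fin d) :=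
  (min (ellFourNorm x) τ / ellFourNorm x) • x

/-- The outer product `x xᵀ`. -/
def outerSelf {d : ℕ} (x : EuclideanSpace ℝ (Fin d)) : Matrix (Fin d) (Fin d) ℝ :=
  Matrix.of fun j k => x j * x k

/-- The shrinkage sample covariance `(1/n) ∑ᵢ x̃ᵢ x̃ᵢᵀ` of the sample `x₁, …, xₙ`, where `x̃ᵢ` is
`xᵢ` shrunk in `ℓ₄` norm at level `τ`. -/
def shrinkageCov {d n : ℕ} (τ : ℝ) (x : Fin n → EuclideanSpace ℝ (Fin d)) :
    Matrix (Fin d) (Fin d) ℝ :=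
  (n : ℝ)⁻¹ • ∑ i, outerSelf (ellFourShrink τ (x i))

/-- The matrix `E(X Xᵀ)` (the covariance matrix, for a mean-zero random vector `X`). -/
def covMatrix {d : ℕ} {Ω : Type*} [MeasurableSpace Ω] (P : Measure Ω)
    (X : Ω → EuclideanSpace ℝ (Fin d)) : Matrix (Fin d) (Fin d) ℝ :=
  Matrix.of fun j k => ∫ ω, X ω j * X ω k ∂P

/-- The operator norm of a square matrix with respect to the Euclidean norm. -/
def matOpNorm {d : ℕ} (A : Matrix (Fin d) (Fin d) ℝ) : ℝ :=
  ‖Matrix.toEuclideanCLM (n := Fin d) (𝕜 := ℝ) A‖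

end

/-!
The error splits into a bias and a stochastic part. Let `x̃` be the shrunk vector and
`T = (n R / (δ log d)) ^ (1 / 2)`, so that `τ²` is of order `T` and the deviation level
`√(δ R d log d / n)` equals `√d R / T`.

*Bias* (`norm_covMatrix_shrink_sub_le`). For a unit vector `v`, `E (v ⬝ x)² - E (v ⬝ x̃)²` only sees
the event `‖x‖₄ > τ`, on which `1 ≤ ‖x‖₄⁴ / τ⁴`. Together with the fourth moment bounds
`E (v ⬝ x)⁴ ≤ R` and `E ‖x‖₄⁴ ≤ d R` this gives a bias of at most `√d R / τ²`, which is a quarter of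
the deviation level as soon as `c₁ ≥ 2`.

*Stochastic part* (`measureReal_le_norm_sum_le`). The matrices `x̃ x̃ᵀ - E x̃ x̃ᵀ` are independent and
centred, they are bounded by `√d τ²` because `‖x̃‖² ≤ √d ‖x̃‖₄²`, and their matrix variance is at
most `d R`, because `‖x̃ x̃ᵀ v‖² = ∑ⱼ x̃ⱼ² (v ⬝ x̃)²` is controlled by fourth moments. A matrix
Bernstein inequality at the Laplace parameter `θ = κ / (√d T)`, with `κ` of order `c₂⁻²`, bounds the
tail by `2 d exp (-(κ / 2) δ log d)`. The factor `2` is absorbed into the exponent, since the claim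
is void unless `C δ > 1`.

The Bernstein inequality follows the method of Ahlswede and Winter (`integral_trace_exp_sum_le`).
It rests on the Golden–Thompson inequality `tr exp (A + B) ≤ tr (exp A exp B)`
(`Matrix.trace_exp_add_le`), which is derived from the Lie product formula
(`tendsto_exp_mul_exp_pow`) and from the trace inequality
`tr (X Y) ^ (2 ^ k) ≤ tr (X ^ (2 ^ k) Y ^ (2 ^ k))` for symmetric matrices
(`Matrix.trace_mul_pow_two_pow_le`).
-/

open scoped Matrix Matrix.Norms.L2Operator Topology
open Filter

/-! ### The Golden–Thompson inequality -/

section TraceInequalities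

variable {m : Type*} [Fintype m]

/-- The Cauchy–Schwarz inequality for the Frobenius inner product. -/
theorem Matrix.trace_mul_sq_le (A B : Matrix m m ℝ) :
    (A * B).trace ^ 2 ≤ (A * Aᵀ).trace * (B * Bᵀ).trace := by
  have h := Finset.sum_mul_sq_le_sq_mul_sq (Finset.univ : Finset (m × m))
    (fun p => A p.1 p.2) (fun p => B p.2 p.1)
  simp only [Fintype.sum_prod_type] at h
  simp only [Matrix.trace, Matrix.diag, Matrix.mul_apply, Matrix.transpose_apply, ← pow_two]
  rwa [Finset.sum_comm (f := fun i j => B i j ^ 2)]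

theorem Matrix.trace_mul_transpose_nonneg (A : Matrix m m ℝ) : 0 ≤ (A * Aᵀ).trace := by
  simp only [Matrix.trace, Matrix.diag, Matrix.mul_apply, Matrix.transpose_apply, ← pow_two]
  positivity

variable [DecidableEq m]

theorem Matrix.trace_mul_pow_comm (A B : Matrix m m ℝ) (k : ℕ) :
    ((A * B) ^ k).trace = ((B * A) ^ k).trace := by
  cases k with
  | zero => simp
  | succ k =>
    rw [pow_succ' (B * A), mul_assoc, Matrix.trace_mul_comm B, pow_succ (A * B)]
    congr 1
    have : ∀ k : ℕ, A * (B * A) ^ k = (A * B) ^ k * A := by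
      intro k
      induction k with
      | zero => simp
      | succ k ih => rw [pow_succ, ← mul_assoc, ih, pow_succ]; simp only [mul_assoc]
    rw [← mul_assoc, this]

theorem Matrix.trace_pow_two_pow_nonneg {P : Matrix m m ℝ} (hP : P.IsSymm) (k : ℕ) :
    0 ≤ (P ^ 2 ^ (k + 1)).trace := by
  have := Matrix.trace_mul_transpose_nonneg (P ^ 2 ^ k)
  rwa [Matrix.transpose_pow, hP.eq, ← pow_add, ← two_mul, ← pow_succ'] at this

/-- A power of a square matrix `M` has trace at most that of the corresponding power of `|M|`, for
exponents that are powers of two. The first claim for `k + 1` follows from both claims for `k`,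
applied to `M ^ 2` and to the pair `Mᵀ M`, `M Mᵀ`; the second claim for `k + 1` follows from the
first one for `k`, applied to `P Q`, together with the second one for `P ^ 2`, `Q ^ 2`. This is why
the two are proved together. -/
theorem Matrix.trace_pow_two_pow_aux (k : ℕ) :
    (∀ M : Matrix m m ℝ, |(M ^ 2 ^ (k + 1)).trace| ≤ ((M * Mᵀ) ^ 2 ^ k).trace) ∧
    (∀ P Q : Matrix m m ℝ, P.IsSymm → Q.IsSymm →
      ((P * Q) ^ 2 ^ k).trace ^ 2 ≤ (P ^ 2 ^ (k + 1)).trace * (Q ^ 2 ^ (k + 1)).trace) := by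
  induction k with
  | zero =>
    constructor
    · intro M
      have h := Matrix.trace_mul_sq_le M M
      rw [← pow_two (M * Mᵀ).trace] at h
      have := abs_le_of_sq_le_sq h (Matrix.trace_mul_transpose_nonneg M)
      simpa [pow_two] using this
    · intro P Q hP hQ
      have h := Matrix.trace_mul_sq_le P Q
      rw [hP.eq, hQ.eq] at h
      simpa [pow_two] using h
  | succ k ih =>
    obtain ⟨ihM, ihPQ⟩ := ih
    have key : ∀ M : Matrix m m ℝ, |(M ^ 2 ^ (k + 2)).trace| ≤ ((M * Mᵀ) ^ 2 ^ (k + 1)).trace := by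
      intro M
      have h1 := ihM (M ^ 2)
      rw [← pow_mul, ← pow_succ'] at h1
      have hs : (M * Mᵀ).IsSymm := Matrix.isSymm_mul_transpose_self M
      have hs' : (Mᵀ * M).IsSymm := Matrix.isSymm_transpose_mul_self M
      have e : ((M ^ 2 * (M ^ 2)ᵀ) ^ 2 ^ k).trace = (((Mᵀ * M) * (M * Mᵀ)) ^ 2 ^ k).trace := by
        have : M ^ 2 * (M ^ 2)ᵀ = M * (M * Mᵀ * Mᵀ) := by
          simp only [pow_two, Matrix.transpose_mul, mul_assoc]
        rw [this, Matrix.trace_mul_pow_comm, Matrix.trace_mul_pow_comm (Mᵀ * M)]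
        simp only [mul_assoc]
      have h2 := ihPQ _ _ hs' hs
      rw [Matrix.trace_mul_pow_comm Mᵀ M, ← pow_two] at h2
      have h3 := abs_le_of_sq_le_sq h2 (Matrix.trace_pow_two_pow_nonneg hs k)
      rw [e] at h1
      exact h1.trans ((le_abs_self _).trans h3)
    refine ⟨key, fun P Q hP hQ => ?_⟩
    have h1 := ihM (P * Q)
    have e : (((P * Q) * (P * Q)ᵀ) ^ 2 ^ k).trace = ((P ^ 2 * Q ^ 2) ^ 2 ^ k).trace := by
      have : (P * Q) * (P * Q)ᵀ = P * (Q ^ 2 * P) := by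
        simp only [Matrix.transpose_mul, hP.eq, hQ.eq, pow_two, mul_assoc]
      rw [this, Matrix.trace_mul_pow_comm, Matrix.trace_mul_pow_comm (P ^ 2), mul_assoc, pow_two P]
    rw [e] at h1
    have h2 := ihPQ (P ^ 2) (Q ^ 2) (hP.pow 2) (hQ.pow 2)
    rw [← pow_mul, ← pow_mul, ← pow_succ'] at h2
    refine le_trans ?_ h2
    rw [← sq_abs]
    exact pow_le_pow_left₀ (abs_nonneg _) h1 2

/-- The Lieb–Thirring trace inequality for symmetric matrices, for exponents that are powers of
two. -/
theorem Matrix.trace_mul_pow_two_pow_le {X Y : Matrix m m ℝ} (hX : X.IsSymm) (hY : Y.IsSymm)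
    (k : ℕ) : ((X * Y) ^ 2 ^ k).trace ≤ (X ^ 2 ^ k * Y ^ 2 ^ k).trace := by
  induction k generalizing X Y with
  | zero => simp
  | succ k ih =>
    have h1 := (le_abs_self _).trans ((Matrix.trace_pow_two_pow_aux k).1 (X * Y))
    have e : (((X * Y) * (X * Y)ᵀ) ^ 2 ^ k).trace = ((X ^ 2 * Y ^ 2) ^ 2 ^ k).trace := by
      have : (X * Y) * (X * Y)ᵀ = X * (Y ^ 2 * X) := by
        simp only [Matrix.transpose_mul, hX.eq, hY.eq, pow_two, mul_assoc]
      rw [this, Matrix.trace_mul_pow_comm, Matrix.trace_mul_pow_comm (X ^ 2), mul_assoc, pow_two X]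
    have h2 := ih (hX.pow 2) (hY.pow 2)
    rw [← pow_mul, ← pow_mul, ← pow_succ'] at h2
    exact h1.trans (e ▸ h2)

end TraceInequalities

section LieProduct

variable {𝔸 : Type*} [NormedRing 𝔸] [NormOneClass 𝔸]

theorem norm_pow_sub_pow_le {X Y : 𝔸} {r : ℝ} (hX : ‖X‖ ≤ r) (hY : ‖Y‖ ≤ r) (n : ℕ) :
    ‖X ^ (n + 1) - Y ^ (n + 1)‖ ≤ (n + 1) * r ^ n * ‖X - Y‖ := by
  have hr : 0 ≤ r := (norm_nonneg X).trans hX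
  induction n with
  | zero => simp
  | succ n ih =>
    have e : X ^ (n + 1 + 1) - Y ^ (n + 1 + 1) =
        X ^ (n + 1) * (X - Y) + (X ^ (n + 1) - Y ^ (n + 1)) * Y := by
      rw [pow_succ X, pow_succ Y (n + 1)]; noncomm_ring
    have h1 : ‖X ^ (n + 1) * (X - Y)‖ ≤ r ^ (n + 1) * ‖X - Y‖ :=
      (norm_mul_le _ _).trans (mul_le_mul_of_nonneg_right
        ((norm_pow_le _ _).trans (pow_le_pow_left₀ (norm_nonneg _) hX _)) (norm_nonneg _))
    have h2 : ‖(X ^ (n + 1) - Y ^ (n + 1)) * Y‖ ≤ (n + 1) * r ^ n * ‖X - Y‖ * r :=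
      (norm_mul_le _ _).trans (mul_le_mul ih hY (norm_nonneg _) (by positivity))
    rw [e]
    refine (norm_add_le _ _).trans ((add_le_add h1 h2).trans (le_of_eq ?_))
    push_cast; ring

variable [NormedAlgebra ℝ 𝔸]

theorem NormedSpace.norm_exp_le_exp_norm (A : 𝔸) : ‖NormedSpace.exp A‖ ≤ Real.exp ‖A‖ := by
  let _ : NormedAlgebra ℚ 𝔸 := NormedAlgebra.restrictScalars ℚ ℝ 𝔸
  rw [NormedSpace.exp_eq_tsum ℝ, Real.exp_eq_exp_ℝ, NormedSpace.exp_eq_tsum ℝ]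
  refine tsum_of_norm_bounded ((NormedSpace.expSeries_summable' (𝕂 := ℝ) ‖A‖).hasSum) fun n => ?_
  rw [norm_smul, smul_eq_mul, Real.norm_of_nonneg (by positivity)]
  gcongr
  exact norm_pow_le _ _

/-- The **Lie product formula** in a real Banach algebra. -/
theorem tendsto_exp_mul_exp_pow [CompleteSpace 𝔸] (A B : 𝔸) :
    Tendsto (fun n : ℕ => (NormedSpace.exp (((n : ℝ) + 1)⁻¹ • A) *
      NormedSpace.exp (((n : ℝ) + 1)⁻¹ • B)) ^ (n + 1)) atTop (𝓝 (NormedSpace.exp (A + B))) := by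
  let _ : NormedAlgebra ℚ 𝔸 := NormedAlgebra.restrictScalars ℚ ℝ 𝔸
  set f : ℝ → 𝔸 := fun t => NormedSpace.exp (t • A) * NormedSpace.exp (t • B)
  set g : ℝ → 𝔸 := fun t => NormedSpace.exp (t • (A + B))
  have hd : HasDerivAt (fun t => f t - g t) 0 0 := by
    have h1 := (hasDerivAt_exp_smul_const A (0 : ℝ))
    have h2 := (hasDerivAt_exp_smul_const B (0 : ℝ))
    have h3 := (hasDerivAt_exp_smul_const (A + B) (0 : ℝ))
    have := (h1.mul h2).sub h3
    have e : (fun t => f t - g t) = ((fun u : ℝ => NormedSpace.exp (u • A)) *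
        fun u : ℝ => NormedSpace.exp (u • B)) - fun u : ℝ => NormedSpace.exp (u • (A + B)) := rfl
    have e0 : NormedSpace.exp ((0 : ℝ) • A) * A * NormedSpace.exp ((0 : ℝ) • B) +
        NormedSpace.exp ((0 : ℝ) • A) * (NormedSpace.exp ((0 : ℝ) • B) * B) -
        NormedSpace.exp ((0 : ℝ) • (A + B)) * (A + B) = 0 := by simp
    rw [e, ← e0]
    exact this
  have hlim : Tendsto (fun n : ℕ => ((n : ℝ) + 1) * ‖f ((n : ℝ) + 1)⁻¹ - g ((n : ℝ) + 1)⁻¹‖)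
      atTop (𝓝 0) := by
    have h := hd.isLittleO
    have hu : Tendsto (fun n : ℕ => ((n : ℝ) + 1)⁻¹) atTop (𝓝 0) := by
      simpa [one_div] using tendsto_one_div_add_atTop_nhds_zero_nat (𝕜 := ℝ)
    have h' := (h.comp_tendsto hu).norm_left.norm_right.tendsto_div_nhds_zero
    refine h'.congr fun n => ?_
    have : (0 : ℝ) < (n : ℝ) + 1 := by positivity
    simp [f, g, abs_of_pos this, div_eq_mul_inv, mul_comm]
  rw [tendsto_iff_norm_sub_tendsto_zero]
  set c := ‖A‖ + ‖B‖
  have hb := hlim.const_mul (Real.exp c)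
  rw [mul_zero] at hb
  refine squeeze_zero (fun _ => norm_nonneg _) (fun n => ?_) hb
  have hn : (0 : ℝ) < (n : ℝ) + 1 := by positivity
  set u : ℝ := ((n : ℝ) + 1)⁻¹ with hu
  have hu0 : 0 < u := inv_pos.2 hn
  have hfn : ‖f u‖ ≤ Real.exp (u * c) := by
    refine (norm_mul_le _ _).trans ?_
    rw [mul_add, Real.exp_add]
    refine mul_le_mul ?_ ?_ (norm_nonneg _) (Real.exp_pos _).le
    all_goals
      refine (NormedSpace.norm_exp_le_exp_norm _).trans (Real.exp_le_exp.2 ?_)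
      rw [norm_smul, Real.norm_of_nonneg hu0.le]
  have hgn : ‖g u‖ ≤ Real.exp (u * c) := by
    refine (NormedSpace.norm_exp_le_exp_norm _).trans (Real.exp_le_exp.2 ?_)
    rw [norm_smul, Real.norm_of_nonneg hu0.le]
    exact mul_le_mul_of_nonneg_left (norm_add_le _ _) hu0.le
  have e : NormedSpace.exp (A + B) = g u ^ (n + 1) := by
    rw [← NormedSpace.exp_nsmul, ← Nat.cast_smul_eq_nsmul ℝ, smul_smul]
    congr 1
    rw [hu]; push_cast
    rw [mul_inv_cancel₀ hn.ne', one_smul]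
  rw [e]
  refine (norm_pow_sub_pow_le hfn hgn n).trans ?_
  have : Real.exp (u * c) ^ n ≤ Real.exp c := by
    rw [← Real.exp_nat_mul]
    refine Real.exp_le_exp.2 ?_
    have hc : 0 ≤ c := by positivity
    have : (n : ℝ) * u ≤ 1 := by
      rw [hu, ← div_eq_mul_inv, div_le_one hn]; linarith
    nlinarith
  calc ((n : ℝ) + 1) * Real.exp (u * c) ^ n * ‖f u - g u‖
      ≤ ((n : ℝ) + 1) * Real.exp c * ‖f u - g u‖ := by gcongr
    _ = _ := by ring

end LieProduct

/-- The **Golden–Thompson inequality** for real symmetric matrices: pass to the limit `k → ∞` in the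
trace inequality for `X = exp (2⁻ᵏ A)`, `Y = exp (2⁻ᵏ B)` and the exponent `2 ^ k`. -/
theorem Matrix.trace_exp_add_le {d : ℕ} {A B : Matrix (Fin d) (Fin d) ℝ}
    (hA : A.IsSymm) (hB : B.IsSymm) :
    (NormedSpace.exp (A + B)).trace ≤ (NormedSpace.exp A * NormedSpace.exp B).trace := by
  rcases Nat.eq_zero_or_pos d with rfl | hd
  · simp [Matrix.trace]
  have : Nonempty (Fin d) := ⟨⟨0, hd⟩⟩
  have hlim := (tendsto_exp_mul_exp_pow A B).comp
    (tendsto_atTop_mono (fun k : ℕ => Nat.sub_le_sub_right (Nat.lt_two_pow_self (n := k)).le 1)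
      (tendsto_sub_atTop_nat 1))
  have htr : Continuous fun M : Matrix (Fin d) (Fin d) ℝ => M.trace := continuous_id.matrix_trace
  refine le_of_tendsto ((htr.tendsto _).comp hlim) (Eventually.of_forall fun k => ?_)
  have h1 : 2 ^ k - 1 + 1 = 2 ^ k := Nat.sub_add_cancel Nat.one_le_two_pow
  have h2 : (((2 ^ k - 1 : ℕ) : ℝ) + 1) = ((2 ^ k : ℕ) : ℝ) := by exact_mod_cast h1
  have h3 : ∀ M : Matrix (Fin d) (Fin d) ℝ,
      NormedSpace.exp (((2 ^ k : ℕ) : ℝ)⁻¹ • M) ^ 2 ^ k = NormedSpace.exp M := by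
    intro M
    rw [← Matrix.exp_nsmul, ← Nat.cast_smul_eq_nsmul ℝ, smul_smul,
      mul_inv_cancel₀ (by positivity), one_smul]
  have h4 := Matrix.trace_mul_pow_two_pow_le
    (Matrix.IsSymm.exp (hA.smul ((2 ^ k : ℕ) : ℝ)⁻¹))
    (Matrix.IsSymm.exp (hB.smul ((2 ^ k : ℕ) : ℝ)⁻¹)) k
  rw [h3, h3] at h4
  simp only [Function.comp_apply, h1, h2]
  exact h4

/-! ### Spectral bounds for symmetric matrices -/

/-- The spectral theorem for real symmetric matrices, with explicit orthogonality relations. -/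
theorem Matrix.IsSymm.exists_eq_mul_diagonal_mul {d : ℕ} {A : Matrix (Fin d) (Fin d) ℝ}
    (hA : A.IsSymm) : ∃ (U : Matrix (Fin d) (Fin d) ℝ) (l : Fin d → ℝ),
      Uᵀ * U = 1 ∧ U * Uᵀ = 1 ∧ A = U * Matrix.diagonal l * Uᵀ := by
  have hH : A.IsHermitian := by rwa [Matrix.IsHermitian, Matrix.conjTranspose_eq_transpose_of_trivial]
  refine ⟨hH.eigenvectorUnitary, hH.eigenvalues, ?_, ?_, ?_⟩
  · simpa [Matrix.star_eq_conjTranspose] using Unitary.coe_star_mul_self hH.eigenvectorUnitary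
  · simpa [Matrix.star_eq_conjTranspose] using Unitary.coe_mul_star_self hH.eigenvectorUnitary
  · have := hH.spectral_theorem
    rw [Unitary.conjStarAlgAut_apply] at this
    simpa [Matrix.star_eq_conjTranspose, Function.comp_def] using this

section Spectral

variable {d : ℕ} {U : Matrix (Fin d) (Fin d) ℝ} (l : Fin d → ℝ)

theorem Matrix.exp_mul_diagonal_mul (h₁ : Uᵀ * U = 1) (h₂ : U * Uᵀ = 1) :
    NormedSpace.exp (U * Matrix.diagonal l * Uᵀ) =
      U * Matrix.diagonal (fun i => Real.exp (l i)) * Uᵀ := by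
  have h := Matrix.exp_units_conj ⟨U, Uᵀ, h₂, h₁⟩ (Matrix.diagonal l)
  rw [Matrix.exp_diagonal] at h
  have e : NormedSpace.exp l = fun i => Real.exp (l i) := by
    funext i; rw [Pi.coe_exp, Real.exp_eq_exp_ℝ]
  rw [e] at h
  exact h

theorem Matrix.dotProduct_mul_diagonal_mul_mulVec (v : Fin d → ℝ) :
    v ⬝ᵥ ((U * Matrix.diagonal l * Uᵀ) *ᵥ v) = ∑ i, l i * (Uᵀ *ᵥ v) i ^ 2 := by
  rw [← Matrix.mulVec_mulVec, ← Matrix.mulVec_mulVec, Matrix.dotProduct_mulVec,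
    ← Matrix.mulVec_transpose]
  simp only [dotProduct, Matrix.mulVec_diagonal]
  exact Finset.sum_congr rfl fun i _ => by ring

end Spectral

section

variable {d : ℕ} {A : Matrix (Fin d) (Fin d) ℝ}

/-- If `A ≤ 1` in the Loewner order, then `exp A ≤ 1 + A + A ^ 2`; only an upper bound on the spectrum
is needed, because `exp x ≤ 1 + x + x ^ 2` for all `x ≤ 1`. -/
theorem Matrix.IsSymm.dotProduct_exp_mulVec_le (hA : A.IsSymm)
    (h : ∀ v : Fin d → ℝ, v ⬝ᵥ (A *ᵥ v) ≤ v ⬝ᵥ v) (v : Fin d → ℝ) :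
    v ⬝ᵥ (NormedSpace.exp A *ᵥ v) ≤ v ⬝ᵥ v + v ⬝ᵥ (A *ᵥ v) + (A *ᵥ v) ⬝ᵥ (A *ᵥ v) := by
  obtain ⟨U, l, h₁, h₂, rfl⟩ := hA.exists_eq_mul_diagonal_mul
  have hl : ∀ i, l i ≤ 1 := by
    intro i
    have := h (U *ᵥ Pi.single i 1)
    rw [Matrix.dotProduct_mul_diagonal_mul_mulVec, Matrix.mulVec_mulVec, h₁,
      Matrix.dotProduct_mulVec, Matrix.vecMul_mulVec, h₁] at this
    simpa [Matrix.one_apply] using this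
  have e0 : v ⬝ᵥ v = ∑ i, (Uᵀ *ᵥ v) i ^ 2 := by
    have := Matrix.dotProduct_mul_diagonal_mul_mulVec (U := U) (fun _ => 1) v
    simpa [h₂] using this
  have e2 : ((U * Matrix.diagonal l * Uᵀ) *ᵥ v) ⬝ᵥ ((U * Matrix.diagonal l * Uᵀ) *ᵥ v) =
      ∑ i, l i ^ 2 * (Uᵀ *ᵥ v) i ^ 2 := by
    rw [← Matrix.dotProduct_mul_diagonal_mul_mulVec (fun i => l i ^ 2) v,
      Matrix.dotProduct_mulVec, ← Matrix.mulVec_transpose, hA.eq, dotProduct_comm,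
      Matrix.mulVec_mulVec]
    congr 2
    calc U * Matrix.diagonal l * Uᵀ * (U * Matrix.diagonal l * Uᵀ)
        = U * Matrix.diagonal l * (Uᵀ * U) * Matrix.diagonal l * Uᵀ := by
          simp only [Matrix.mul_assoc]
      _ = _ := by
          rw [h₁, Matrix.mul_one, Matrix.mul_assoc U, Matrix.diagonal_mul_diagonal]
          simp only [pow_two]
  rw [Matrix.exp_mul_diagonal_mul l h₁ h₂, e2, e0, Matrix.dotProduct_mul_diagonal_mul_mulVec,
    Matrix.dotProduct_mul_diagonal_mul_mulVec, ← Finset.sum_add_distrib, ← Finset.sum_add_distrib]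
  refine Finset.sum_le_sum fun i _ => ?_
  have : Real.exp (l i) ≤ 1 + l i + l i ^ 2 := by
    rcases le_or_gt (-1) (l i) with h' | h'
    · have := Real.abs_exp_sub_one_sub_id_le (abs_le.2 ⟨h', hl i⟩)
      linarith [le_abs_self (Real.exp (l i) - 1 - l i)]
    · have : Real.exp (l i) ≤ 1 := Real.exp_le_one_iff.2 (by linarith)
      nlinarith
  nlinarith [mul_le_mul_of_nonneg_right this (sq_nonneg ((Uᵀ *ᵥ v) i))]

theorem Matrix.IsSymm.exists_le_abs_eigenvalue (hA : A.IsSymm) {s : ℝ} (hs : 0 < s)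
    (h : s ≤ ‖A‖) : ∃ (U : Matrix (Fin d) (Fin d) ℝ) (l : Fin d → ℝ) (i : Fin d),
      Uᵀ * U = 1 ∧ U * Uᵀ = 1 ∧ A = U * Matrix.diagonal l * Uᵀ ∧ s ≤ |l i| := by
  obtain ⟨U, l, h₁, h₂, rfl⟩ := hA.exists_eq_mul_diagonal_mul
  refine ⟨U, l, ?_⟩
  simp only [h₁, h₂, true_and]
  by_contra! hlt
  have hU : ‖U‖ ≤ 1 := by
    have := Matrix.l2_opNorm_conjTranspose_mul_self U
    rw [Matrix.conjTranspose_eq_transpose_of_trivial, h₁] at this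
    have h1 : ‖(1 : Matrix (Fin d) (Fin d) ℝ)‖ ≤ 1 := by
      rw [← Matrix.diagonal_one, Matrix.l2_opNorm_diagonal]
      exact (pi_norm_le_iff_of_nonneg zero_le_one).2 fun i => by simp
    nlinarith [norm_nonneg U]
  have hU' : ‖Uᵀ‖ ≤ 1 := by
    rwa [← Matrix.conjTranspose_eq_transpose_of_trivial, Matrix.l2_opNorm_conjTranspose]
  have hD : ‖Matrix.diagonal l‖ < s := by
    rw [Matrix.l2_opNorm_diagonal]
    exact (pi_norm_lt_iff hs).2 fun i => by simpa using hlt i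
  have : ‖U * Matrix.diagonal l * Uᵀ‖ ≤ ‖Matrix.diagonal l‖ := by
    calc ‖U * Matrix.diagonal l * Uᵀ‖ ≤ ‖U‖ * ‖Matrix.diagonal l‖ * ‖Uᵀ‖ :=
          (norm_mul_le _ _).trans (mul_le_mul_of_nonneg_right (norm_mul_le _ _) (norm_nonneg _))
      _ ≤ 1 * ‖Matrix.diagonal l‖ * 1 := by gcongr
      _ = _ := by ring
  linarith

theorem Matrix.IsSymm.norm_le_of_abs_dotProduct_mulVec_le (hA : A.IsSymm) {b : ℝ} (hb : 0 ≤ b)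
    (h : ∀ v : Fin d → ℝ, v ⬝ᵥ v = 1 → |v ⬝ᵥ (A *ᵥ v)| ≤ b) : ‖A‖ ≤ b := by
  by_contra! hlt
  obtain ⟨U, l, i, h₁, h₂, rfl, hi⟩ := hA.exists_le_abs_eigenvalue (hb.trans_lt hlt) le_rfl
  have := h (U *ᵥ Pi.single i 1) (by
    rw [Matrix.dotProduct_mulVec, Matrix.vecMul_mulVec, h₁]; simp)
  rw [Matrix.dotProduct_mul_diagonal_mul_mulVec, Matrix.mulVec_mulVec, h₁] at this
  simp [Matrix.one_apply] at this
  linarith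

/-- The reduction of the operator norm to exponential traces: `A` or `-A` has an eigenvalue that is at
least `s`. -/
theorem Matrix.IsSymm.exp_le_trace_exp_add_trace_exp_neg (hA : A.IsSymm) {s : ℝ} (hs : 0 < s)
    (h : s ≤ ‖A‖) : Real.exp s ≤ (NormedSpace.exp A).trace + (NormedSpace.exp (-A)).trace := by
  obtain ⟨U, l, i, h₁, h₂, rfl, hi⟩ := hA.exists_le_abs_eigenvalue hs h
  have e : -(U * Matrix.diagonal l * Uᵀ) = U * Matrix.diagonal (fun i => -l i) * Uᵀ := by
    rw [← Matrix.diagonal_neg, Matrix.mul_neg, Matrix.neg_mul]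
  have ht : ∀ f : Fin d → ℝ, (U * Matrix.diagonal f * Uᵀ).trace = ∑ i, f i := by
    intro f
    rw [Matrix.trace_mul_comm, ← Matrix.mul_assoc, h₁, Matrix.one_mul, Matrix.trace_diagonal]
  rw [e, Matrix.exp_mul_diagonal_mul _ h₁ h₂, Matrix.exp_mul_diagonal_mul _ h₁ h₂, ht, ht,
    ← Finset.sum_add_distrib]
  refine le_trans ?_ (Finset.single_le_sum
    (f := fun i => Real.exp (l i) + Real.exp (-l i)) (fun _ _ => by positivity)
    (Finset.mem_univ i))
  rcases le_abs.1 hi with h' | h'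
  · linarith [Real.exp_le_exp.2 h', Real.exp_pos (-l i)]
  · linarith [Real.exp_le_exp.2 h', Real.exp_pos (l i)]

/-- If `P ≥ 0` and `Q ≤ c` as quadratic forms, then `tr (P Q) ≤ c tr P`. `Q` need not be symmetric. -/
theorem Matrix.IsSymm.trace_mul_le {P Q : Matrix (Fin d) (Fin d) ℝ} (hP : P.IsSymm)
    (hP0 : ∀ v : Fin d → ℝ, 0 ≤ v ⬝ᵥ (P *ᵥ v)) {c : ℝ}
    (hQ : ∀ v : Fin d → ℝ, v ⬝ᵥ (Q *ᵥ v) ≤ c * v ⬝ᵥ v) :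
    (P * Q).trace ≤ c * P.trace := by
  obtain ⟨U, l, h₁, h₂, rfl⟩ := hP.exists_eq_mul_diagonal_mul
  have hl : ∀ i, 0 ≤ l i := by
    intro i
    have := hP0 (U *ᵥ Pi.single i 1)
    rw [Matrix.dotProduct_mul_diagonal_mul_mulVec, Matrix.mulVec_mulVec, h₁] at this
    simpa [Matrix.one_apply] using this
  have ht : ∀ M : Matrix (Fin d) (Fin d) ℝ,
      (U * Matrix.diagonal l * Uᵀ * M).trace =
        ∑ i, l i * ((fun j => U j i) ⬝ᵥ (M *ᵥ fun j => U j i)) := by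
    intro M
    rw [Matrix.mul_assoc, Matrix.mul_assoc, Matrix.trace_mul_comm, Matrix.mul_assoc,
      Matrix.mul_assoc, Matrix.trace]
    refine Finset.sum_congr rfl fun i _ => ?_
    rw [Matrix.diag, Matrix.diagonal_mul]
    congr 1
  have h1 := ht 1
  rw [Matrix.mul_one] at h1
  rw [ht, h1, Finset.mul_sum]
  refine Finset.sum_le_sum fun i _ => ?_
  have := mul_le_mul_of_nonneg_left (hQ fun j => U j i) (hl i)
  rw [Matrix.one_mulVec]
  linarith

end

/-! ### A Bernstein inequality for sums of random symmetric matrices -/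

theorem Matrix.abs_apply_le_l2_opNorm {d : ℕ} (A : Matrix (Fin d) (Fin d) ℝ) (j k : Fin d) :
    |A j k| ≤ ‖A‖ := by
  have h := Matrix.l2_opNorm_mulVec A (EuclideanSpace.single k (1 : ℝ))
  rw [show ‖EuclideanSpace.single k (1 : ℝ)‖ = 1 by simp, mul_one] at h
  refine le_trans ?_ h
  have h' := PiLp.norm_apply_le (WithLp.toLp 2 (A *ᵥ (EuclideanSpace.single k (1 : ℝ)).ofLp)) j
  simpa using h'

theorem Matrix.IsSymm.dotProduct_exp_mulVec_nonneg {d : ℕ} {A : Matrix (Fin d) (Fin d) ℝ}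
    (hA : A.IsSymm) (v : Fin d → ℝ) : 0 ≤ v ⬝ᵥ (NormedSpace.exp A *ᵥ v) := by
  obtain ⟨U, l, h₁, h₂, rfl⟩ := hA.exists_eq_mul_diagonal_mul
  rw [Matrix.exp_mul_diagonal_mul l h₁ h₂, Matrix.dotProduct_mul_diagonal_mul_mulVec]
  positivity

theorem Matrix.dotProduct_mulVec_eq_sum {d : ℕ} (A : Matrix (Fin d) (Fin d) ℝ) (v : Fin d → ℝ) :
    v ⬝ᵥ (A *ᵥ v) = ∑ j, ∑ k, v j * v k * A j k := by
  simp only [dotProduct, Matrix.mulVec, Finset.mul_sum]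
  exact Finset.sum_congr rfl fun j _ => Finset.sum_congr rfl fun k _ => by ring

section Bernstein

variable {Ω : Type*} [MeasurableSpace Ω] {P : Measure Ω}

theorem dotProduct_integral_mulVec {d : ℕ} {M : Ω → Matrix (Fin d) (Fin d) ℝ}
    (hM : ∀ j k, Integrable (fun ω => M ω j k) P) (v : Fin d → ℝ) :
    v ⬝ᵥ (Matrix.of (fun j k => ∫ ω, M ω j k ∂P) *ᵥ v) = ∫ ω, v ⬝ᵥ (M ω *ᵥ v) ∂P := by
  simp only [Matrix.dotProduct_mulVec_eq_sum]
  rw [integral_finsetSum _ fun j _ => integrable_finsetSum _ fun k _ => (hM j k).const_mul _]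
  refine Finset.sum_congr rfl fun j _ => ?_
  rw [integral_finsetSum _ fun k _ => (hM j k).const_mul _]
  exact Finset.sum_congr rfl fun k _ => by rw [integral_const_mul]; rfl

theorem integrable_dotProduct_mulVec {d : ℕ} {M : Ω → Matrix (Fin d) (Fin d) ℝ}
    (hM : ∀ j k, Integrable (fun ω => M ω j k) P) (v : Fin d → ℝ) :
    Integrable (fun ω => v ⬝ᵥ (M ω *ᵥ v)) P := by
  simp only [Matrix.dotProduct_mulVec_eq_sum]
  exact integrable_finsetSum _ fun j _ => integrable_finsetSum _ fun k _ => (hM j k).const_mul _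

variable [IsProbabilityMeasure P] {ι : Type*} {d : ℕ} {S : ι → Ω → Fin d → Fin d → ℝ}
  {L σ θ : ℝ}

theorem continuous_exp_smul_apply (θ : ℝ) (j k : Fin d) : Continuous fun A : Fin d → Fin d → ℝ =>
    NormedSpace.exp (θ • (Matrix.of A : Matrix (Fin d) (Fin d) ℝ)) j k := by
  have h1 : Continuous (NormedSpace.exp : Matrix (Fin d) (Fin d) ℝ → Matrix (Fin d) (Fin d) ℝ) := by
    let _ : NormedAlgebra ℚ (Matrix (Fin d) (Fin d) ℝ) := NormedAlgebra.restrictScalars ℚ ℝ _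
    exact NormedSpace.exp_continuous
  have h2 : Continuous fun A : Fin d → Fin d → ℝ =>
      θ • (Matrix.of A : Matrix (Fin d) (Fin d) ℝ) := by
    have : Continuous fun A : Fin d → Fin d → ℝ => (Matrix.of A : Matrix (Fin d) (Fin d) ℝ) :=
      continuous_id
    exact this.const_smul θ
  exact (h1.comp h2).matrix_elem j k

theorem norm_of_le_of_abs_dotProduct_le (hL0 : 0 ≤ L) {A : Matrix (Fin d) (Fin d) ℝ}
    (hA : A.IsSymm) (hL : ∀ v : Fin d → ℝ, |v ⬝ᵥ (A *ᵥ v)| ≤ L * v ⬝ᵥ v) : ‖A‖ ≤ L :=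
  hA.norm_le_of_abs_dotProduct_mulVec_le hL0 fun v hv => by simpa [hv] using hL v

theorem integrable_exp_sum_apply (hd : 0 < d) (hm : ∀ i, AEMeasurable (S i) P)
    (hL : ∀ i ω, ‖(Matrix.of (S i ω) : Matrix (Fin d) (Fin d) ℝ)‖ ≤ L) (s : Finset ι)
    (j k : Fin d) :
    Integrable (fun ω => NormedSpace.exp
      (θ • (Matrix.of ((∑ i ∈ s, S i) ω) : Matrix (Fin d) (Fin d) ℝ)) j k) P := by
  have : Nonempty (Fin d) := ⟨⟨0, hd⟩⟩
  have hsum : AEMeasurable (∑ i ∈ s, S i) P := Finset.aemeasurable_sum s fun i _ => hm i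
  refine Integrable.of_bound ((continuous_exp_smul_apply θ j k).measurable.comp_aemeasurable
    hsum).aestronglyMeasurable (Real.exp (|θ| * (s.card * L))) (Eventually.of_forall fun ω => ?_)
  refine (Matrix.abs_apply_le_l2_opNorm _ j k).trans
    ((NormedSpace.norm_exp_le_exp_norm _).trans (Real.exp_le_exp.2 ?_))
  rw [norm_smul, Real.norm_eq_abs]
  refine mul_le_mul_of_nonneg_left ?_ (abs_nonneg θ)
  have e : (Matrix.of ((∑ i ∈ s, S i) ω) : Matrix (Fin d) (Fin d) ℝ) =
      ∑ i ∈ s, Matrix.of (S i ω) := by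
    rw [Finset.sum_apply]; rfl
  rw [e]
  refine (norm_sum_le_of_le s fun i _ => hL i ω).trans ?_
  simp

theorem Matrix.IsSymm.sum {s : Finset ι} {A : ι → Matrix (Fin d) (Fin d) ℝ}
    (h : ∀ i, (A i).IsSymm) : (∑ i ∈ s, A i).IsSymm := by
  rw [Matrix.IsSymm, Matrix.transpose_sum]
  exact Finset.sum_congr rfl fun i _ => (h i).eq

/-- The Ahlswede–Winter bound `E tr exp (θ ∑ Sᵢ) ≤ d (1 + θ² σ) ^ #s` for independent, centred and
bounded random symmetric matrices with `E Sᵢ² ≤ σ`. The matrices are peeled off one at a time: the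
Golden–Thompson inequality separates the last one from the others, independence turns the
expectation of the trace of the product into `tr (E exp (θ ∑ Sᵢ) · E exp (θ Sₐ))`, and
`E exp (θ Sₐ) ≤ 1 + θ² E Sₐ²` as the linear term is centred.

The matrices are given as functions `Fin d → Fin d → ℝ`, a type which carries a σ-algebra. -/
theorem integral_trace_exp_sum_le (hd : 0 < d) (hS : iIndepFun S P)
    (hm : ∀ i, AEMeasurable (S i) P)
    (hsymm : ∀ i ω, (Matrix.of (S i ω)).IsSymm)
    (hL0 : 0 ≤ L)
    (hL : ∀ i ω, ∀ v : Fin d → ℝ, |v ⬝ᵥ (Matrix.of (S i ω) *ᵥ v)| ≤ L * v ⬝ᵥ v)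
    (h0 : ∀ i j k, ∫ ω, S i ω j k ∂P = 0)
    (hσ0 : 0 ≤ σ)
    (hσ : ∀ i, ∀ v : Fin d → ℝ,
      ∫ ω, (Matrix.of (S i ω) *ᵥ v) ⬝ᵥ (Matrix.of (S i ω) *ᵥ v) ∂P ≤ σ * v ⬝ᵥ v)
    (hθ : |θ| * L ≤ 1) (s : Finset ι) :
    ∫ ω, (NormedSpace.exp
      (θ • (Matrix.of ((∑ i ∈ s, S i) ω) : Matrix (Fin d) (Fin d) ℝ))).trace ∂P ≤
      d * (1 + θ ^ 2 * σ) ^ s.card := by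
  classical
  have hnorm : ∀ i ω, ‖(Matrix.of (S i ω) : Matrix (Fin d) (Fin d) ℝ)‖ ≤ L := fun i ω =>
    norm_of_le_of_abs_dotProduct_le hL0 (hsymm i ω) (hL i ω)
  have hsymms : ∀ (s : Finset ι) ω,
      (Matrix.of ((∑ i ∈ s, S i) ω) : Matrix (Fin d) (Fin d) ℝ).IsSymm := by
    intro s ω
    have : (Matrix.of ((∑ i ∈ s, S i) ω) : Matrix (Fin d) (Fin d) ℝ) =
        ∑ i ∈ s, Matrix.of (S i ω) := by
      rw [Finset.sum_apply]; rfl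
    rw [this]
    exact Matrix.IsSymm.sum fun i => hsymm i ω
  induction s using Finset.induction_on with
  | empty =>
    have : (Matrix.of (0 : Fin d → Fin d → ℝ) : Matrix (Fin d) (Fin d) ℝ) = 0 := rfl
    simp [this]
  | insert a s ha ih =>
    set X : Ω → Matrix (Fin d) (Fin d) ℝ := fun ω =>
      NormedSpace.exp (θ • (Matrix.of ((∑ i ∈ s, S i) ω) : Matrix (Fin d) (Fin d) ℝ)) with hX
    set Y : Ω → Matrix (Fin d) (Fin d) ℝ := fun ω =>
      NormedSpace.exp (θ • (Matrix.of (S a ω) : Matrix (Fin d) (Fin d) ℝ)) with hY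
    have hXi : ∀ j k, Integrable (fun ω => X ω j k) P := fun j k =>
      integrable_exp_sum_apply hd hm hnorm s j k
    have hYi : ∀ j k, Integrable (fun ω => Y ω j k) P := fun j k => by
      have := integrable_exp_sum_apply (θ := θ) hd hm hnorm {a} j k
      simpa only [Finset.sum_singleton] using this
    have hind : IndepFun (∑ i ∈ s, S i) (S a) P := hS.indepFun_finsetSum_of_notMem₀ hm ha
    have hXYind : ∀ j k j' k', IndepFun (fun ω => X ω j k) (fun ω => Y ω j' k') P :=
      fun j k j' k' => hind.comp (continuous_exp_smul_apply θ j k).measurable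
        (continuous_exp_smul_apply θ j' k').measurable
    have hXY : ∀ j k, Integrable (fun ω => X ω j k * Y ω k j) P := fun j k =>
      (hXYind j k k j).integrable_mul (hXi j k) (hYi k j)
    have hstep : ∀ ω, (NormedSpace.exp (θ • (Matrix.of ((∑ i ∈ insert a s, S i) ω) :
        Matrix (Fin d) (Fin d) ℝ))).trace ≤ ∑ j, ∑ k, X ω j k * Y ω k j := by
      intro ω
      have e : (Matrix.of ((∑ i ∈ insert a s, S i) ω) : Matrix (Fin d) (Fin d) ℝ) =
          Matrix.of ((∑ i ∈ s, S i) ω) + Matrix.of (S a ω) := by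
        rw [Finset.sum_insert ha, add_comm]; rfl
      rw [e, smul_add]
      refine (Matrix.trace_exp_add_le ((hsymms s ω).smul θ) ((hsymm a ω).smul θ)).trans ?_
      simp [Matrix.trace, Matrix.mul_apply, hX, hY]
    set Pm : Matrix (Fin d) (Fin d) ℝ := Matrix.of fun j k => ∫ ω, X ω j k ∂P with hPm
    set Q : Matrix (Fin d) (Fin d) ℝ := Matrix.of fun j k => ∫ ω, Y ω j k ∂P with hQ
    have hint : ∫ ω, ∑ j, ∑ k, X ω j k * Y ω k j ∂P = (Pm * Q).trace := by
      rw [integral_finsetSum _ fun j _ => integrable_finsetSum _ fun k _ => hXY j k]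
      simp only [Matrix.trace, Matrix.diag, Matrix.mul_apply]
      refine Finset.sum_congr rfl fun j _ => ?_
      rw [integral_finsetSum _ fun k _ => hXY j k]
      refine Finset.sum_congr rfl fun k _ => ?_
      exact (hXYind j k k j).integral_fun_mul_eq_mul_integral (hXi j k).aestronglyMeasurable
        (hYi k j).aestronglyMeasurable
    have hPsymm : Pm.IsSymm := by
      ext j k
      simp only [hPm, Matrix.transpose_apply, Matrix.of_apply]
      congr 1
      funext ω
      exact (Matrix.IsSymm.exp ((hsymms s ω).smul θ)).apply j k
    have hPnn : ∀ v : Fin d → ℝ, 0 ≤ v ⬝ᵥ (Pm *ᵥ v) := by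
      intro v
      rw [hPm, dotProduct_integral_mulVec hXi]
      exact integral_nonneg fun ω =>
        Matrix.IsSymm.dotProduct_exp_mulVec_nonneg ((hsymms s ω).smul θ) v
    have hSm : ∀ j k, AEStronglyMeasurable (fun ω => S a ω j k) P := fun j k =>
      ((show Measurable fun A : Fin d → Fin d → ℝ => A j k by fun_prop).comp_aemeasurable
        (hm a)).aestronglyMeasurable
    have hSb : ∀ j k ω, |S a ω j k| ≤ L := fun j k ω =>
      (Matrix.abs_apply_le_l2_opNorm (Matrix.of (S a ω)) j k).trans (hnorm a ω)
    have hSi : ∀ j k, Integrable (fun ω => (Matrix.of (S a ω) : Matrix (Fin d) (Fin d) ℝ) j k) P :=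
      fun j k => Integrable.of_bound (hSm j k) L (Eventually.of_forall (hSb j k))
    have hSSi : ∀ v : Fin d → ℝ,
        Integrable (fun ω => (Matrix.of (S a ω) *ᵥ v) ⬝ᵥ (Matrix.of (S a ω) *ᵥ v)) P := by
      intro v
      simp only [dotProduct, Matrix.mulVec, Matrix.of_apply, Finset.sum_mul, Finset.mul_sum]
      refine integrable_finsetSum _ fun j _ => integrable_finsetSum _ fun k _ =>
        integrable_finsetSum _ fun k' _ => ?_
      have h1 : Integrable (fun ω => S a ω j k * S a ω j k') P :=
        (hSi j k').bdd_mul (hSm j k) (Eventually.of_forall (hSb j k))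
      refine (h1.const_mul (v k * v k')).congr (Eventually.of_forall fun ω => ?_)
      simp only; ring
    have hQle : ∀ v : Fin d → ℝ, v ⬝ᵥ (Q *ᵥ v) ≤ (1 + θ ^ 2 * σ) * v ⬝ᵥ v := by
      intro v
      rw [hQ, dotProduct_integral_mulVec hYi]
      have hpt : ∀ ω, v ⬝ᵥ (Y ω *ᵥ v) ≤ v ⬝ᵥ v + θ * (v ⬝ᵥ (Matrix.of (S a ω) *ᵥ v)) +
          θ ^ 2 * ((Matrix.of (S a ω) *ᵥ v) ⬝ᵥ (Matrix.of (S a ω) *ᵥ v)) := by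
        intro ω
        have := ((hsymm a ω).smul θ).dotProduct_exp_mulVec_le (fun w => by
          rw [Matrix.smul_mulVec, dotProduct_smul, smul_eq_mul]
          have hw : 0 ≤ w ⬝ᵥ w := Finset.sum_nonneg fun i _ => mul_self_nonneg _
          calc θ * (w ⬝ᵥ (Matrix.of (S a ω) *ᵥ w))
              ≤ |θ| * |w ⬝ᵥ (Matrix.of (S a ω) *ᵥ w)| := by
                rw [← abs_mul]; exact le_abs_self _
            _ ≤ |θ| * (L * w ⬝ᵥ w) := mul_le_mul_of_nonneg_left (hL a ω w) (abs_nonneg _)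
            _ = |θ| * L * w ⬝ᵥ w := by ring
            _ ≤ w ⬝ᵥ w := mul_le_of_le_one_left hw hθ) v
        simp only [Matrix.smul_mulVec, dotProduct_smul, smul_dotProduct, smul_eq_mul] at this
        rw [hY]
        linarith
      have hi1 : Integrable (fun ω => v ⬝ᵥ v + θ * (v ⬝ᵥ (Matrix.of (S a ω) *ᵥ v))) P :=
        (integrable_const _).add ((integrable_dotProduct_mulVec hSi v).const_mul θ)
      have hi2 := (hSSi v).const_mul (θ ^ 2)
      refine (integral_mono (integrable_dotProduct_mulVec hYi v) (hi1.add hi2) hpt).trans ?_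
      simp only [Pi.add_apply]
      rw [integral_add hi1 hi2, integral_add (integrable_const _)
        ((integrable_dotProduct_mulVec hSi v).const_mul θ), integral_const_mul, integral_const_mul,
        ← dotProduct_integral_mulVec hSi]
      have hz : (Matrix.of fun j k => ∫ ω, (Matrix.of (S a ω) : Matrix (Fin d) (Fin d) ℝ) j k ∂P) =
          (0 : Matrix (Fin d) (Fin d) ℝ) := by
        ext j k; exact h0 a j k
      rw [hz]
      have := mul_le_mul_of_nonneg_left (hσ a v) (sq_nonneg θ)
      simp only [integral_const, probReal_univ, one_smul, Matrix.zero_mulVec, dotProduct_zero]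
      linarith
    have hPtr : Pm.trace = ∫ ω, (X ω).trace ∂P := by
      simp only [Matrix.trace, Matrix.diag]
      rw [integral_finsetSum _ fun j _ => hXi j j]
      rfl
    have hc : 0 ≤ 1 + θ ^ 2 * σ := by positivity
    have hins : Integrable (fun ω => (NormedSpace.exp (θ • (Matrix.of
        ((∑ i ∈ insert a s, S i) ω) : Matrix (Fin d) (Fin d) ℝ))).trace) P := by
      simp only [Matrix.trace, Matrix.diag]
      exact integrable_finsetSum _ fun j _ => integrable_exp_sum_apply hd hm hnorm _ j j
    calc _ ≤ ∫ ω, ∑ j, ∑ k, X ω j k * Y ω k j ∂P := integral_mono hins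
          (integrable_finsetSum _ fun j _ => integrable_finsetSum _ fun k _ => hXY j k) hstep
      _ = (Pm * Q).trace := hint
      _ ≤ (1 + θ ^ 2 * σ) * Pm.trace := hPsymm.trace_mul_le hPnn hQle
      _ ≤ (1 + θ ^ 2 * σ) * (d * (1 + θ ^ 2 * σ) ^ s.card) := by
          rw [hPtr]; exact mul_le_mul_of_nonneg_left ih hc
      _ = _ := by rw [Finset.card_insert_of_notMem ha, pow_succ]; ring

/-- A **matrix Bernstein inequality**, before optimization over the parameter `θ` of the Laplace
transform. -/
theorem measureReal_le_norm_sum_le [Fintype ι] (hd : 0 < d) (hS : iIndepFun S P)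
    (hm : ∀ i, AEMeasurable (S i) P)
    (hsymm : ∀ i ω, (Matrix.of (S i ω)).IsSymm)
    (hL0 : 0 ≤ L)
    (hL : ∀ i ω, ∀ v : Fin d → ℝ, |v ⬝ᵥ (Matrix.of (S i ω) *ᵥ v)| ≤ L * v ⬝ᵥ v)
    (h0 : ∀ i j k, ∫ ω, S i ω j k ∂P = 0)
    (hσ0 : 0 ≤ σ)
    (hσ : ∀ i, ∀ v : Fin d → ℝ,
      ∫ ω, (Matrix.of (S i ω) *ᵥ v) ⬝ᵥ (Matrix.of (S i ω) *ᵥ v) ∂P ≤ σ * v ⬝ᵥ v)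
    (hθ0 : 0 < θ) (hθ : θ * L ≤ 1) {s : ℝ} (hs : 0 < s) :
    P.real {ω | s ≤ ‖(Matrix.of (∑ i, S i ω) : Matrix (Fin d) (Fin d) ℝ)‖} ≤
      2 * d * Real.exp (Fintype.card ι * (θ ^ 2 * σ) - θ * s) := by
  classical
  have hnorm : ∀ i ω, ‖(Matrix.of (S i ω) : Matrix (Fin d) (Fin d) ℝ)‖ ≤ L := fun i ω =>
    norm_of_le_of_abs_dotProduct_le hL0 (hsymm i ω) (hL i ω)
  set F : ℝ → Ω → ℝ := fun t ω => (NormedSpace.exp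
    (t • (Matrix.of ((∑ i, S i) ω) : Matrix (Fin d) (Fin d) ℝ))).trace with hF
  have hFi : ∀ t, Integrable (F t) P := fun t => by
    simp only [hF, Matrix.trace, Matrix.diag]
    exact integrable_finsetSum _ fun j _ => integrable_exp_sum_apply hd hm hnorm _ j j
  have hsym : ∀ ω, (Matrix.of ((∑ i, S i) ω) : Matrix (Fin d) (Fin d) ℝ).IsSymm := by
    intro ω
    have : (Matrix.of ((∑ i, S i) ω) : Matrix (Fin d) (Fin d) ℝ) = ∑ i, Matrix.of (S i ω) := by
      rw [Finset.sum_apply]; rfl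
    rw [this]
    exact Matrix.IsSymm.sum fun i => hsymm i ω
  have hF0 : ∀ t ω, 0 ≤ F t ω := fun t ω => by
    refine Finset.sum_nonneg fun i _ => ?_
    have := Matrix.IsSymm.dotProduct_exp_mulVec_nonneg ((hsym ω).smul t) (Pi.single i 1)
    simpa using this
  have hFb : ∀ t, |t| = θ → ∫ ω, F t ω ∂P ≤
      d * Real.exp (Fintype.card ι * (θ ^ 2 * σ)) := by
    intro t ht
    refine (integral_trace_exp_sum_le (θ := t) hd hS hm hsymm hL0 hL h0 hσ0 hσ
      (by rw [ht]; exact hθ) Finset.univ).trans ?_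
    rw [← sq_abs t, ht, Real.exp_nat_mul, Finset.card_univ]
    gcongr
    linarith [Real.add_one_le_exp (θ ^ 2 * σ)]
  have hmarkov := mul_meas_ge_le_integral_of_nonneg (μ := P) (f := fun ω => F θ ω + F (-θ) ω)
    (Eventually.of_forall fun ω => add_nonneg (hF0 _ _) (hF0 _ _)) ((hFi θ).add (hFi (-θ)))
    (Real.exp (θ * s))
  rw [integral_add (hFi θ) (hFi (-θ))] at hmarkov
  have hsub : {ω | s ≤ ‖(Matrix.of (∑ i, S i ω) : Matrix (Fin d) (Fin d) ℝ)‖} ⊆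
      {ω | Real.exp (θ * s) ≤ F θ ω + F (-θ) ω} := by
    intro ω hω
    have e : (Matrix.of (∑ i, S i ω) : Matrix (Fin d) (Fin d) ℝ) = Matrix.of ((∑ i, S i) ω) := by
      rw [Finset.sum_apply]
    have hω' : s ≤ ‖(Matrix.of ((∑ i, S i) ω) : Matrix (Fin d) (Fin d) ℝ)‖ := by
      rw [← e]; exact hω
    have := ((hsym ω).smul θ).exp_le_trace_exp_add_trace_exp_neg (s := θ * s) (by positivity) (by
      rw [norm_smul, Real.norm_of_nonneg hθ0.le]
      exact mul_le_mul_of_nonneg_left hω' hθ0.le)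
    rw [← neg_smul] at this
    exact this
  have h1 := hFb θ (abs_of_pos hθ0)
  have h2 := hFb (-θ) (by rw [abs_neg, abs_of_pos hθ0])
  refine (measureReal_mono hsub).trans ?_
  rw [Real.exp_sub, mul_div_assoc', le_div_iff₀ (Real.exp_pos _), mul_comm]
  linarith

end Bernstein

/-! ### Shrinkage in the `ℓ₄` norm -/

section Shrink

variable {d : ℕ}

theorem ellFourNorm_nonneg (x : EuclideanSpace ℝ (Fin d)) : 0 ≤ ellFourNorm x := by
  unfold ellFourNorm; positivity

theorem ellFourNorm_pow_four (x : EuclideanSpace ℝ (Fin d)) :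
    ellFourNorm x ^ 4 = ∑ j, x j ^ 4 := by
  have h : 0 ≤ ∑ j, |x j| ^ 4 := by positivity
  rw [ellFourNorm, ← Real.rpow_natCast, ← Real.rpow_mul h]
  norm_num
  exact Finset.sum_congr rfl fun j _ => Even.pow_abs (by decide) _

theorem min_div_mem_Icc {m τ : ℝ} (hm : 0 ≤ m) (hτ : 0 ≤ τ) : 0 ≤ min m τ / m ∧ min m τ / m ≤ 1 :=
  ⟨div_nonneg (le_min hm hτ) hm, div_le_one_of_le₀ (min_le_left _ _) hm⟩

theorem ellFourShrink_apply (τ : ℝ) (x : EuclideanSpace ℝ (Fin d)) (j : Fin d) :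
    ellFourShrink τ x j = min (ellFourNorm x) τ / ellFourNorm x * x j := rfl

theorem measurable_ellFourShrink (τ : ℝ) :
    Measurable (ellFourShrink τ : EuclideanSpace ℝ (Fin d) → EuclideanSpace ℝ (Fin d)) := by
  have h : Measurable (ellFourNorm : EuclideanSpace ℝ (Fin d) → ℝ) := by
    unfold ellFourNorm; fun_prop
  unfold ellFourShrink
  fun_prop

theorem sum_ellFourShrink_pow_four_le {τ : ℝ} (hτ : 0 ≤ τ) (x : EuclideanSpace ℝ (Fin d)) :
    ∑ j, ellFourShrink τ x j ^ 4 ≤ τ ^ 4 := by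
  have hm := ellFourNorm_nonneg x
  simp only [ellFourShrink_apply, mul_pow]
  rw [← Finset.mul_sum, ← ellFourNorm_pow_four, ← mul_pow]
  refine pow_le_pow_left₀ (mul_nonneg (min_div_mem_Icc hm hτ).1 hm) ?_ 4
  rcases hm.eq_or_lt with h | h
  · rw [← h, mul_zero]; exact hτ
  · rw [div_mul_cancel₀ _ h.ne']; exact min_le_right _ _

theorem sum_ellFourShrink_sq_le {τ : ℝ} (hτ : 0 ≤ τ) (x : EuclideanSpace ℝ (Fin d)) :
    ∑ j, ellFourShrink τ x j ^ 2 ≤ Real.sqrt d * τ ^ 2 := by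
  refine abs_le_of_sq_le_sq' ?_ (by positivity) |>.2
  have h := sq_sum_le_card_mul_sum_sq (s := (Finset.univ : Finset (Fin d)))
    (f := fun j => ellFourShrink τ x j ^ 2)
  simp only [← pow_mul, Finset.card_univ, Fintype.card_fin] at h
  refine h.trans ?_
  rw [mul_pow, Real.sq_sqrt (Nat.cast_nonneg d), ← pow_mul]
  exact mul_le_mul_of_nonneg_left (sum_ellFourShrink_pow_four_le hτ x) (Nat.cast_nonneg d)

theorem dotProduct_ellFourShrink (τ : ℝ) (x : EuclideanSpace ℝ (Fin d)) (v : Fin d → ℝ) :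
    v ⬝ᵥ (ellFourShrink τ x).ofLp = min (ellFourNorm x) τ / ellFourNorm x * v ⬝ᵥ x.ofLp := by
  rw [← smul_eq_mul, ← dotProduct_smul]; rfl

theorem outerSelf_mulVec (x : EuclideanSpace ℝ (Fin d)) (v : Fin d → ℝ) (j : Fin d) :
    (outerSelf x *ᵥ v) j = x j * v ⬝ᵥ x.ofLp := by
  simp only [outerSelf, Matrix.mulVec, dotProduct, Matrix.of_apply, Finset.mul_sum]
  exact Finset.sum_congr rfl fun k _ => by ring

theorem dotProduct_outerSelf_mulVec (x : EuclideanSpace ℝ (Fin d)) (v : Fin d → ℝ) :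
    v ⬝ᵥ (outerSelf x *ᵥ v) = (v ⬝ᵥ x.ofLp) ^ 2 := by
  rw [dotProduct]
  simp only [outerSelf_mulVec]
  rw [pow_two]
  nth_rw 2 [dotProduct]
  rw [Finset.sum_mul]
  exact Finset.sum_congr rfl fun k _ => by ring

theorem dotProduct_sq_le (v w : Fin d → ℝ) : (v ⬝ᵥ w) ^ 2 ≤ (∑ j, w j ^ 2) * v ⬝ᵥ v := by
  have h := Finset.sum_mul_sq_le_sq_mul_sq (Finset.univ : Finset (Fin d)) v w
  rw [mul_comm]
  simpa only [dotProduct, pow_two] using h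

theorem dotProduct_ellFourShrink_sq_le {τ : ℝ} (hτ : 0 ≤ τ) (x : EuclideanSpace ℝ (Fin d))
    (v : Fin d → ℝ) : (v ⬝ᵥ (ellFourShrink τ x).ofLp) ^ 2 ≤ Real.sqrt d * τ ^ 2 * v ⬝ᵥ v :=
  (dotProduct_sq_le v _).trans (mul_le_mul_of_nonneg_right (sum_ellFourShrink_sq_le hτ x)
    (Finset.sum_nonneg fun _ _ => mul_self_nonneg _))

theorem abs_ellFourShrink_mul_le {τ : ℝ} (hτ : 0 ≤ τ) (x : EuclideanSpace ℝ (Fin d))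
    (j k : Fin d) : |ellFourShrink τ x j * ellFourShrink τ x k| ≤ Real.sqrt d * τ ^ 2 := by
  have h : ∀ j, ellFourShrink τ x j ^ 2 ≤ Real.sqrt d * τ ^ 2 := fun j =>
    (Finset.single_le_sum (f := fun j => ellFourShrink τ x j ^ 2) (fun _ _ => sq_nonneg _)
      (Finset.mem_univ j)).trans (sum_ellFourShrink_sq_le hτ x)
  rw [abs_le]
  constructor <;> nlinarith [h j, h k, sq_nonneg (ellFourShrink τ x j + ellFourShrink τ x k),
    sq_nonneg (ellFourShrink τ x j - ellFourShrink τ x k)]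

/-- The pointwise source of the bias bound. The difference vanishes unless `‖x‖₄ > τ`; in that case
`(v ⬝ x)² ≤ (α (v ⬝ x)⁴ + α⁻¹) / 2`, and `1 ≤ ‖x‖₄⁴ / τ⁴`. The parameter `α` is to be optimized after
integration. -/
theorem dotProduct_sq_sub_shrink_sq_le {τ α : ℝ} (hτ : 0 < τ) (hα : 0 < α)
    (x : EuclideanSpace ℝ (Fin d)) (v : Fin d → ℝ) :
    0 ≤ (v ⬝ᵥ x.ofLp) ^ 2 - (v ⬝ᵥ (ellFourShrink τ x).ofLp) ^ 2 ∧
    (v ⬝ᵥ x.ofLp) ^ 2 - (v ⬝ᵥ (ellFourShrink τ x).ofLp) ^ 2 ≤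
      α / 2 * (v ⬝ᵥ x.ofLp) ^ 4 + (2 * α * τ ^ 4)⁻¹ * ∑ j, x j ^ 4 := by
  have hm := ellFourNorm_nonneg x
  rw [dotProduct_ellFourShrink, mul_pow, ← ellFourNorm_pow_four]
  obtain ⟨h0, h1⟩ := min_div_mem_Icc hm hτ.le
  set s := min (ellFourNorm x) τ / ellFourNorm x with hs
  set y := v ⬝ᵥ x.ofLp with hy
  have hs2 : s ^ 2 ≤ 1 := pow_le_one₀ h0 h1
  refine ⟨by nlinarith [sq_nonneg y], ?_⟩
  have hr : 0 ≤ α / 2 * y ^ 4 + (2 * α * τ ^ 4)⁻¹ * ellFourNorm x ^ 4 := by positivity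
  rcases hm.eq_or_lt with h | h
  · have hx : ∀ j, x j = 0 := by
      have : ∑ j, x j ^ 4 = 0 := by rw [← ellFourNorm_pow_four, ← h]; norm_num
      intro j
      have := (Finset.sum_eq_zero_iff_of_nonneg fun j _ => by positivity).1 this j
        (Finset.mem_univ j)
      exact pow_eq_zero_iff (by norm_num) |>.1 this
    have : y = 0 := by
      rw [hy]; exact Finset.sum_eq_zero fun j _ => by rw [hx j, mul_zero]
    rw [this] at hr ⊢
    linarith
  rcases le_or_gt (ellFourNorm x) τ with h' | h'
  · have : s = 1 := by rw [hs, min_eq_left h', div_self h.ne']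
    rw [this]; linarith
  · have e : (2 * α * τ ^ 4)⁻¹ * ellFourNorm x ^ 4 = (2 * α)⁻¹ * (ellFourNorm x / τ) ^ 4 := by
      rw [div_pow, mul_inv]; field_simp
    have h2 : 1 ≤ (ellFourNorm x / τ) ^ 4 := one_le_pow₀ ((one_le_div hτ).2 h'.le)
    have h3 : y ^ 2 ≤ α / 2 * y ^ 4 + (2 * α)⁻¹ := by
      have : α / 2 * y ^ 4 + (2 * α)⁻¹ - y ^ 2 = (α * y ^ 2 - 1) ^ 2 / (2 * α) := by
        field_simp; ring
      have h4 : 0 ≤ (α * y ^ 2 - 1) ^ 2 / (2 * α) := by positivity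
      linarith
    have h5 : (2 * α)⁻¹ ≤ (2 * α)⁻¹ * (ellFourNorm x / τ) ^ 4 :=
      le_mul_of_one_le_right (by positivity) h2
    rw [e]
    nlinarith [mul_nonneg (sq_nonneg s) (sq_nonneg y)]

/-- The pointwise bound on `‖x̃ x̃ᵀ v‖²` behind the variance bound. The weight `q` balances the two
fourth moments and is to be taken equal to `‖v‖²`. -/
theorem sum_ellFourShrink_sq_mul_le {τ q : ℝ} (hτ : 0 ≤ τ) (hq : 0 < q)
    (x : EuclideanSpace ℝ (Fin d)) (v : Fin d → ℝ) :
    ∑ j, (ellFourShrink τ x j * v ⬝ᵥ (ellFourShrink τ x).ofLp) ^ 2 ≤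
      q / 2 * ∑ j, x j ^ 4 + d / (2 * q) * (v ⬝ᵥ x.ofLp) ^ 4 := by
  obtain ⟨h0, h1⟩ := min_div_mem_Icc (ellFourNorm_nonneg x) hτ
  have e : d / (2 * q) * (v ⬝ᵥ x.ofLp) ^ 4 = ∑ _j : Fin d, (v ⬝ᵥ x.ofLp) ^ 4 / (2 * q) := by
    simp; ring
  rw [e, Finset.mul_sum, ← Finset.sum_add_distrib]
  refine Finset.sum_le_sum fun j _ => ?_
  rw [dotProduct_ellFourShrink, ellFourShrink_apply]
  set s := min (ellFourNorm x) τ / ellFourNorm x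
  set y := v ⬝ᵥ x.ofLp
  have hs : s ^ 4 ≤ 1 := pow_le_one₀ h0 h1
  calc (s * x j * (s * y)) ^ 2 = s ^ 4 * (x j * y) ^ 2 := by ring
    _ ≤ 1 * (x j * y) ^ 2 := by gcongr
    _ ≤ q / 2 * x j ^ 4 + y ^ 4 / (2 * q) := by
      have : q / 2 * x j ^ 4 + y ^ 4 / (2 * q) - (x j * y) ^ 2 =
          (q * x j ^ 2 - y ^ 2) ^ 2 / (2 * q) := by field_simp; ring
      have h4 : 0 ≤ (q * x j ^ 2 - y ^ 2) ^ 2 / (2 * q) := by positivity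
      linarith

end Shrink

/-! ### Moments of the shrunk vector -/

section Moments

variable {d : ℕ} {Ω : Type*} [MeasurableSpace Ω] {P : Measure Ω}
  {X : Ω → EuclideanSpace ℝ (Fin d)} {R τ : ℝ}

theorem covMatrix_isSymm (X : Ω → EuclideanSpace ℝ (Fin d)) : (covMatrix P X).IsSymm := by
  ext j k
  simp only [covMatrix, Matrix.transpose_apply, Matrix.of_apply, mul_comm]

theorem outerSelf_isSymm (x : EuclideanSpace ℝ (Fin d)) : (outerSelf x).IsSymm := by
  ext j k
  simp only [outerSelf, Matrix.transpose_apply, Matrix.of_apply, mul_comm]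

theorem dotProduct_covMatrix_mulVec (hX : ∀ j k, Integrable (fun ω => X ω j * X ω k) P)
    (v : Fin d → ℝ) :
    Integrable (fun ω => (v ⬝ᵥ (X ω).ofLp) ^ 2) P ∧
      v ⬝ᵥ (covMatrix P X *ᵥ v) = ∫ ω, (v ⬝ᵥ (X ω).ofLp) ^ 2 ∂P := by
  have h1 := integrable_dotProduct_mulVec (M := fun ω => outerSelf (X ω)) hX v
  have h2 := dotProduct_integral_mulVec (M := fun ω => outerSelf (X ω)) hX v
  simp only [dotProduct_outerSelf_mulVec] at h1 h2
  exact ⟨h1, h2⟩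

variable [IsProbabilityMeasure P]

/-- The fourth moment hypothesis, extended from unit vectors by homogeneity. -/
theorem integrable_dotProduct_pow_four (hX : AEMeasurable X P) (hR : 0 ≤ R)
    (h4 : ∀ v : EuclideanSpace ℝ (Fin d), ‖v‖ = 1 →
      ∫⁻ ω, ENNReal.ofReal ((inner ℝ v (X ω)) ^ 4) ∂P ≤ ENNReal.ofReal R) (v : Fin d → ℝ) :
    Integrable (fun ω => (v ⬝ᵥ (X ω).ofLp) ^ 4) P ∧
      ∫ ω, (v ⬝ᵥ (X ω).ofLp) ^ 4 ∂P ≤ R * (v ⬝ᵥ v) ^ 2 := by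
  have hunit : ∀ u : EuclideanSpace ℝ (Fin d), ‖u‖ = 1 →
      Integrable (fun ω => (inner ℝ u (X ω)) ^ 4) P ∧ ∫ ω, (inner ℝ u (X ω)) ^ 4 ∂P ≤ R := by
    intro u hu
    have hm : AEStronglyMeasurable (fun ω => (inner ℝ u (X ω)) ^ 4) P :=
      ((show Measurable fun y : EuclideanSpace ℝ (Fin d) => (inner ℝ u y) ^ 4 by
        fun_prop).comp_aemeasurable hX).aestronglyMeasurable
    have h0 : 0 ≤ᵐ[P] fun ω => (inner ℝ u (X ω)) ^ 4 := Eventually.of_forall fun ω => by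
      simp only [Pi.zero_apply]; positivity
    refine ⟨⟨hm, ?_⟩, ?_⟩
    · rw [hasFiniteIntegral_iff_ofReal h0]
      exact (h4 u hu).trans_lt ENNReal.ofReal_lt_top
    · rw [integral_eq_lintegral_of_nonneg_ae h0 hm]
      exact ENNReal.toReal_le_of_le_ofReal hR (h4 u hu)
  have hin : ∀ (u : EuclideanSpace ℝ (Fin d)) ω, inner ℝ u (X ω) = u.ofLp ⬝ᵥ (X ω).ofLp := by
    intro u ω
    rw [EuclideanSpace.inner_eq_star_dotProduct, dotProduct_comm]; simp
  by_cases hv : v = 0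
  · simp [hv]
  set w : EuclideanSpace ℝ (Fin d) := WithLp.toLp 2 v with hw
  have hw0 : w ≠ 0 := by
    intro h; exact hv (by simpa [hw] using h)
  have hwn : ‖w‖ ≠ 0 := norm_ne_zero_iff.2 hw0
  have hvv : v ⬝ᵥ v = ‖w‖ ^ 2 := by
    rw [EuclideanSpace.norm_sq_eq]
    simp [dotProduct, hw, pow_two]
  obtain ⟨h1, h2⟩ := hunit (‖w‖⁻¹ • w) (by rw [norm_smul, norm_inv, norm_norm, inv_mul_cancel₀ hwn])
  have e : ∀ ω, (v ⬝ᵥ (X ω).ofLp) ^ 4 = ‖w‖ ^ 4 * (inner ℝ (‖w‖⁻¹ • w) (X ω)) ^ 4 := by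
    intro ω
    rw [real_inner_smul_left, ← mul_pow, ← mul_assoc, mul_inv_cancel₀ hwn, one_mul, hin]
  simp only [e, hvv]
  refine ⟨h1.const_mul _, ?_⟩
  rw [integral_const_mul]
  nlinarith [mul_le_mul_of_nonneg_left h2 (show 0 ≤ ‖w‖ ^ 4 by positivity)]

theorem integrable_apply_pow_four (hX : AEMeasurable X P) (hR : 0 ≤ R)
    (h4 : ∀ v : EuclideanSpace ℝ (Fin d), ‖v‖ = 1 →
      ∫⁻ ω, ENNReal.ofReal ((inner ℝ v (X ω)) ^ 4) ∂P ≤ ENNReal.ofReal R) (j : Fin d) :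
    Integrable (fun ω => X ω j ^ 4) P ∧ ∫ ω, X ω j ^ 4 ∂P ≤ R := by
  have := integrable_dotProduct_pow_four hX hR h4 (Pi.single j 1)
  simpa using this

theorem integrable_sum_pow_four (hX : AEMeasurable X P) (hR : 0 ≤ R)
    (h4 : ∀ v : EuclideanSpace ℝ (Fin d), ‖v‖ = 1 →
      ∫⁻ ω, ENNReal.ofReal ((inner ℝ v (X ω)) ^ 4) ∂P ≤ ENNReal.ofReal R) :
    Integrable (fun ω => ∑ j, X ω j ^ 4) P ∧ ∫ ω, ∑ j, X ω j ^ 4 ∂P ≤ d * R := by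
  have h := integrable_apply_pow_four hX hR h4
  refine ⟨integrable_finsetSum _ fun j _ => (h j).1, ?_⟩
  rw [integral_finsetSum _ fun j _ => (h j).1]
  refine (Finset.sum_le_sum fun j _ => (h j).2).trans ?_
  simp

theorem integrable_apply_mul_apply (hX : AEMeasurable X P) (hR : 0 ≤ R)
    (h4 : ∀ v : EuclideanSpace ℝ (Fin d), ‖v‖ = 1 →
      ∫⁻ ω, ENNReal.ofReal ((inner ℝ v (X ω)) ^ 4) ∂P ≤ ENNReal.ofReal R) (j k : Fin d) :
    Integrable (fun ω => X ω j * X ω k) P := by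
  have h := integrable_apply_pow_four hX hR h4
  refine (((integrable_const (1 : ℝ)).add (h j).1).add (h k).1).mono'
    ((show Measurable fun y : EuclideanSpace ℝ (Fin d) => y j * y k by
        fun_prop).comp_aemeasurable hX).aestronglyMeasurable (Eventually.of_forall fun ω => ?_)
  rw [Real.norm_eq_abs, abs_le]
  simp only [Pi.add_apply]
  constructor <;> nlinarith [sq_nonneg (X ω j ^ 2 - 1), sq_nonneg (X ω k ^ 2 - 1),
    sq_nonneg (X ω j - X ω k), sq_nonneg (X ω j + X ω k), sq_nonneg (X ω j ^ 2),
    sq_nonneg (X ω k ^ 2)]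

theorem integrable_ellFourShrink_mul (hX : AEMeasurable X P) (hτ : 0 ≤ τ) (j k : Fin d) :
    Integrable (fun ω => ellFourShrink τ (X ω) j * ellFourShrink τ (X ω) k) P :=
  Integrable.of_bound ((show Measurable fun y : EuclideanSpace ℝ (Fin d) => y j * y k by
    fun_prop).comp_aemeasurable ((measurable_ellFourShrink τ).comp_aemeasurable
      hX)).aestronglyMeasurable _ (Eventually.of_forall fun ω =>
        abs_ellFourShrink_mul_le hτ (X ω) j k)

/-- The bias of the shrinkage covariance. -/
theorem norm_covMatrix_shrink_sub_le (hd : 0 < d) (hX : AEMeasurable X P) (hR : 0 ≤ R)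
    (hτ : 0 < τ) (h4 : ∀ v : EuclideanSpace ℝ (Fin d), ‖v‖ = 1 →
      ∫⁻ ω, ENNReal.ofReal ((inner ℝ v (X ω)) ^ 4) ∂P ≤ ENNReal.ofReal R) :
    ‖covMatrix P (fun ω => ellFourShrink τ (X ω)) - covMatrix P X‖ ≤
      Real.sqrt d * R / τ ^ 2 := by
  refine ((covMatrix_isSymm _).sub (covMatrix_isSymm X)).norm_le_of_abs_dotProduct_mulVec_le
    (by positivity) fun v hv => ?_
  obtain ⟨hi1, he1⟩ := dotProduct_covMatrix_mulVec (integrable_apply_mul_apply hX hR h4) v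
  obtain ⟨hi2, he2⟩ := dotProduct_covMatrix_mulVec (X := fun ω => ellFourShrink τ (X ω))
    (integrable_ellFourShrink_mul hX hτ.le) v
  have hd' : 0 < Real.sqrt d := Real.sqrt_pos.2 (by exact_mod_cast hd)
  -- This value makes the two fourth moment terms `α R` and `α⁻¹ d R / τ⁴` equal.
  set α := Real.sqrt d / τ ^ 2 with hα
  have hα0 : 0 < α := by positivity
  have hpt := fun ω => dotProduct_sq_sub_shrink_sq_le hτ hα0 (X ω) v
  obtain ⟨hi3, he3⟩ := integrable_dotProduct_pow_four hX hR h4 v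
  obtain ⟨hi4, he4⟩ := integrable_sum_pow_four hX hR h4
  rw [hv] at he3
  rw [Matrix.sub_mulVec, dotProduct_sub, he1, he2, abs_sub_comm, ← integral_sub hi1 hi2,
    abs_of_nonneg (integral_nonneg fun ω => (hpt ω).1)]
  refine (integral_mono (hi1.sub hi2) ((hi3.const_mul _).add (hi4.const_mul _))
    fun ω => (hpt ω).2).trans ?_
  rw [integral_add' (hi3.const_mul _) (hi4.const_mul _), integral_const_mul, integral_const_mul]
  have h5 : (2 * α * τ ^ 4)⁻¹ * (d * R) = α * R / 2 := by
    have : (d : ℝ) = Real.sqrt d ^ 2 := (Real.sq_sqrt (Nat.cast_nonneg d)).symm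
    rw [this, hα]
    field_simp
  calc α / 2 * ∫ ω, (v ⬝ᵥ (X ω).ofLp) ^ 4 ∂P + (2 * α * τ ^ 4)⁻¹ * ∫ ω, ∑ j, X ω j ^ 4 ∂P
      ≤ α / 2 * (R * 1 ^ 2) + (2 * α * τ ^ 4)⁻¹ * (d * R) := by gcongr
    _ = Real.sqrt d * R / τ ^ 2 := by rw [h5, hα]; ring

theorem abs_dotProduct_outerSelf_sub_covMatrix_le (hX : AEMeasurable X P) (hτ : 0 ≤ τ)
    (x : EuclideanSpace ℝ (Fin d)) (v : Fin d → ℝ) :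
    |v ⬝ᵥ ((outerSelf (ellFourShrink τ x) -
      covMatrix P (fun ω => ellFourShrink τ (X ω))) *ᵥ v)| ≤ Real.sqrt d * τ ^ 2 * v ⬝ᵥ v := by
  obtain ⟨hi, he⟩ := dotProduct_covMatrix_mulVec (X := fun ω => ellFourShrink τ (X ω))
    (integrable_ellFourShrink_mul hX hτ) v
  rw [Matrix.sub_mulVec, dotProduct_sub, dotProduct_outerSelf_mulVec, he]
  refine abs_sub_le_of_nonneg_of_le (sq_nonneg _) (dotProduct_ellFourShrink_sq_le hτ x v)
    (integral_nonneg fun ω => sq_nonneg _) ?_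
  refine (integral_mono hi (integrable_const _) fun ω =>
    dotProduct_ellFourShrink_sq_le hτ (X ω) v).trans ?_
  simp

/-- The matrix variance `E (x̃ x̃ᵀ - E x̃ x̃ᵀ)²` of a shrunk vector is at most `d R`. -/
theorem integral_outerSelf_sub_covMatrix_sq_le (hX : AEMeasurable X P) (hR : 0 ≤ R)
    (hτ : 0 ≤ τ) (h4 : ∀ v : EuclideanSpace ℝ (Fin d), ‖v‖ = 1 →
      ∫⁻ ω, ENNReal.ofReal ((inner ℝ v (X ω)) ^ 4) ∂P ≤ ENNReal.ofReal R) (v : Fin d → ℝ) :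
    ∫ ω, ((outerSelf (ellFourShrink τ (X ω)) -
        covMatrix P (fun ω => ellFourShrink τ (X ω))) *ᵥ v) ⬝ᵥ
      ((outerSelf (ellFourShrink τ (X ω)) -
        covMatrix P (fun ω => ellFourShrink τ (X ω))) *ᵥ v) ∂P ≤ d * R * v ⬝ᵥ v := by
  by_cases hv : v = 0
  · simp [hv]
  have hq : 0 < v ⬝ᵥ v := lt_of_le_of_ne (Finset.sum_nonneg fun _ _ => mul_self_nonneg _)
    fun h => hv (dotProduct_self_eq_zero.1 h.symm)
  set Z : Fin d → Ω → ℝ := fun j ω =>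
    ellFourShrink τ (X ω) j * v ⬝ᵥ (ellFourShrink τ (X ω)).ofLp with hZ
  have hsh : AEMeasurable (fun ω => ellFourShrink τ (X ω)) P :=
    (measurable_ellFourShrink τ).comp_aemeasurable hX
  have hZm : ∀ j, AEMeasurable (Z j) P := fun j =>
    (show Measurable fun y : EuclideanSpace ℝ (Fin d) => y j * v ⬝ᵥ y.ofLp by
      simp only [dotProduct]; fun_prop).comp_aemeasurable hsh
  have hZb : ∀ j ω, |Z j ω| ≤ ∑ k, |v k| * (Real.sqrt d * τ ^ 2) := by
    intro j ω
    simp only [hZ, dotProduct, Finset.mul_sum]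
    refine (Finset.abs_sum_le_sum_abs _ _).trans (Finset.sum_le_sum fun k _ => ?_)
    rw [← mul_left_comm, abs_mul]
    exact mul_le_mul_of_nonneg_left (abs_ellFourShrink_mul_le hτ (X ω) j k) (abs_nonneg _)
  have hZi2 : ∀ j, MemLp (Z j) 2 P := fun j =>
    MemLp.of_bound (hZm j).aestronglyMeasurable _ (Eventually.of_forall (hZb j))
  have hmean : ∀ j, (covMatrix P (fun ω => ellFourShrink τ (X ω)) *ᵥ v) j = ∫ ω, Z j ω ∂P := by
    intro j
    simp only [hZ, dotProduct, Finset.mul_sum, covMatrix, Matrix.mulVec, Matrix.of_apply]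
    rw [integral_finsetSum _ fun k _ => ?_]
    · refine Finset.sum_congr rfl fun k _ => ?_
      rw [← integral_mul_const]
      congr 1; funext ω; ring
    · refine ((integrable_ellFourShrink_mul hX hτ j k).const_mul (v k)).congr
        (Eventually.of_forall fun ω => ?_)
      simp only; ring
  have e : ∀ ω, ((outerSelf (ellFourShrink τ (X ω)) -
        covMatrix P (fun ω => ellFourShrink τ (X ω))) *ᵥ v) ⬝ᵥ
      ((outerSelf (ellFourShrink τ (X ω)) -
        covMatrix P (fun ω => ellFourShrink τ (X ω))) *ᵥ v) =
      ∑ j, (Z j ω - ∫ ω, Z j ω ∂P) ^ 2 := by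
    intro ω
    simp only [dotProduct, Matrix.sub_mulVec, Pi.sub_apply, hmean, outerSelf_mulVec, pow_two]
    rfl
  simp only [e]
  have hvar : ∀ j, ∫ ω, (Z j ω - ∫ ω, Z j ω ∂P) ^ 2 ∂P ≤ ∫ ω, Z j ω ^ 2 ∂P := by
    intro j
    rw [← variance_eq_integral (hZm j)]
    exact variance_le_expectation_sq (hZm j).aestronglyMeasurable
  have hint : ∀ j, Integrable (fun ω => (Z j ω - ∫ ω, Z j ω ∂P) ^ 2) P := fun j =>
    ((hZi2 j).sub (memLp_const _)).integrable_sq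
  rw [integral_finsetSum _ fun j _ => hint j]
  refine (Finset.sum_le_sum fun j _ => hvar j).trans ?_
  rw [← integral_finsetSum _ fun j _ => (hZi2 j).integrable_sq]
  obtain ⟨hi3, he3⟩ := integrable_dotProduct_pow_four hX hR h4 v
  obtain ⟨hi4, he4⟩ := integrable_sum_pow_four hX hR h4
  refine (integral_mono (integrable_finsetSum _ fun j _ => (hZi2 j).integrable_sq)
    ((hi4.const_mul _).add (hi3.const_mul _))
    fun ω => sum_ellFourShrink_sq_mul_le hτ hq (X ω) v).trans ?_
  rw [integral_add' (hi4.const_mul _) (hi3.const_mul _), integral_const_mul, integral_const_mul]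
  calc _ ≤ v ⬝ᵥ v / 2 * (d * R) + d / (2 * v ⬝ᵥ v) * (R * (v ⬝ᵥ v) ^ 2) := by gcongr
    _ = d * R * v ⬝ᵥ v := by field_simp; ring

end Moments

/-! ### Deviation of the shrinkage covariance -/

/-- The deviation bound with the bias `√d R / τ²` separated from the stochastic error `t`, for every
admissible parameter `θ` of the Laplace transform. -/
theorem measureReal_le_matOpNorm_shrinkageCov_sub_le {n d : ℕ} {R τ θ t : ℝ} (hn : 0 < n)
    (hd : 0 < d) (hR : 0 ≤ R) (hτ : 0 < τ) (ht : 0 < t)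
    {Ω : Type*} [MeasurableSpace Ω] {P : Measure Ω} [IsProbabilityMeasure P]
    {x : Fin n → Ω → EuclideanSpace ℝ (Fin d)} (hind : iIndepFun x P)
    (hid : ∀ i j, IdentDistrib (x i) (x j) P P)
    (h4 : ∀ i, ∀ v : EuclideanSpace ℝ (Fin d), ‖v‖ = 1 →
      ∫⁻ ω, ENNReal.ofReal ((inner ℝ v (x i ω)) ^ 4) ∂P ≤ ENNReal.ofReal R)
    (hθ0 : 0 < θ) (hθ : θ * (Real.sqrt d * τ ^ 2) ≤ 1) (k : Fin n) :
    P.real {ω | t + Real.sqrt d * R / τ ^ 2 ≤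
        matOpNorm (shrinkageCov τ (fun i => x i ω) - covMatrix P (x k))} ≤
      2 * d * Real.exp (n * (θ ^ 2 * (d * R)) - θ * (n * t)) := by
  have hX : ∀ i, AEMeasurable (x i) P := fun i => (hid i i).aemeasurable_fst
  set G : Matrix (Fin d) (Fin d) ℝ := covMatrix P fun ω => ellFourShrink τ (x k ω) with hG
  have hGi : ∀ i, covMatrix P (fun ω => ellFourShrink τ (x i ω)) = G := by
    intro i
    ext j l
    have hm : Measurable fun y : EuclideanSpace ℝ (Fin d) =>
        ellFourShrink τ y j * ellFourShrink τ y l :=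
      (show Measurable fun y : EuclideanSpace ℝ (Fin d) => y j * y l by fun_prop).comp
        (measurable_ellFourShrink τ)
    have := ((hid i k).comp hm).integral_eq
    simp only [hG, covMatrix, Matrix.of_apply]
    exact this
  set g : EuclideanSpace ℝ (Fin d) → Fin d → Fin d → ℝ := fun y j l =>
    outerSelf (ellFourShrink τ y) j l - G j l with hg
  have hgm : Measurable g := by
    refine measurable_pi_iff.2 fun j => measurable_pi_iff.2 fun l => ?_
    exact ((show Measurable fun y : EuclideanSpace ℝ (Fin d) => y j * y l by fun_prop).comp
        (measurable_ellFourShrink τ)).sub_const _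
  have hbern := measureReal_le_norm_sum_le (P := P) (S := fun i ω => g (x i ω))
    (L := Real.sqrt d * τ ^ 2) (σ := d * R) (θ := θ) hd
    (hind.comp (fun _ => g) fun _ => hgm)
    (fun i => hgm.comp_aemeasurable (hX i))
    (fun i ω => (outerSelf_isSymm _).sub (covMatrix_isSymm _)) (by positivity)
    (fun i ω v => abs_dotProduct_outerSelf_sub_covMatrix_le (hX k) hτ.le (x i ω) v)
    (fun i j l => by
      have := integral_sub (integrable_ellFourShrink_mul (hX i) hτ.le j l)
        (integrable_const (μ := P) (G j l))
      refine this.trans ?_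
      rw [← hGi i]
      simp [covMatrix])
    (by positivity)
    (fun i v => by
      have := integral_outerSelf_sub_covMatrix_sq_le (hX i) hR hτ.le (h4 i) v
      rw [hGi i] at this
      exact this)
    hθ0 hθ (s := n * t) (by positivity)
  rw [Fintype.card_fin] at hbern
  refine (measureReal_mono fun ω hω => ?_).trans hbern
  have hn' : (0 : ℝ) < n := by exact_mod_cast hn
  have hb := norm_covMatrix_shrink_sub_le hd (hX k) hR hτ (h4 k)
  have e : shrinkageCov τ (fun i => x i ω) - covMatrix P (x k) =
      (n : ℝ)⁻¹ • (Matrix.of (∑ i, g (x i ω)) : Matrix (Fin d) (Fin d) ℝ) +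
        (G - covMatrix P (x k)) := by
    have : (Matrix.of (∑ i, g (x i ω)) : Matrix (Fin d) (Fin d) ℝ) =
        ∑ i, (outerSelf (ellFourShrink τ (x i ω)) - G) := rfl
    rw [this, Finset.sum_sub_distrib, shrinkageCov, smul_sub]
    simp only [Finset.sum_const, Finset.card_univ, Fintype.card_fin]
    rw [← Nat.cast_smul_eq_nsmul ℝ, smul_smul, inv_mul_cancel₀ hn'.ne', one_smul]
    abel
  have h1 : t + Real.sqrt d * R / τ ^ 2 ≤
      ‖shrinkageCov τ (fun i => x i ω) - covMatrix P (x k)‖ := hω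
  rw [e] at h1
  have h2 := norm_add_le ((n : ℝ)⁻¹ • (Matrix.of (∑ i, g (x i ω)) : Matrix (Fin d) (Fin d) ℝ))
    (G - covMatrix P (x k))
  rw [norm_smul, norm_inv, Real.norm_of_nonneg hn'.le] at h2
  have h3 : t ≤ (n : ℝ)⁻¹ * ‖(Matrix.of (∑ i, g (x i ω)) : Matrix (Fin d) (Fin d) ℝ)‖ := by
    linarith
  rwa [le_inv_mul_iff₀ hn'] at h3

/-- The factor `2` from the two-sided tail is absorbed by half of the exponent: if `c ≤ 1`, then
`d ^ (1 - c) ≥ 1` bounds any probability, and if `c > 1`, then `2 ≤ d ≤ d ^ c`. -/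
theorem two_mul_mul_exp_le_rpow {d c p : ℝ} (hd : 2 ≤ d) (hp1 : p ≤ 1)
    (hp : p ≤ 2 * d * Real.exp (-(2 * c) * Real.log d)) : p ≤ d ^ (1 - c) := by
  have hd0 : 0 < d := by linarith
  rcases le_or_gt c 1 with h | h
  · exact hp1.trans (Real.one_le_rpow (by linarith) (by linarith))
  · refine hp.trans ?_
    have hlog : 0 < Real.log d := Real.log_pos (by linarith)
    have h2 : (2 : ℝ) ≤ Real.exp (c * Real.log d) := by
      refine hd.trans ?_
      conv_lhs => rw [← Real.exp_log hd0]
      exact Real.exp_le_exp.2 (by nlinarith)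
    have e : d ^ (1 - c) =
        Real.exp (c * Real.log d) * d * Real.exp (-(2 * c) * Real.log d) := by
      rw [Real.rpow_def_of_pos hd0]
      nth_rw 3 [← Real.exp_log hd0]
      rw [← Real.exp_add, ← Real.exp_add]
      congr 1; ring
    rw [e]
    gcongr

theorem theorem6 :
    ∃ c₀ : ℝ, 0 < c₀ ∧ ∀ c₁ c₂ : ℝ, c₀ ≤ c₁ → c₁ ≤ c₂ →
      ∃ C : ℝ, 0 < C ∧
        ∀ (n d : ℕ) (R δ τ : ℝ), 1 ≤ n → 2 ≤ d → 0 < R → 0 < δ →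
          c₁ * ((n : ℝ) * R / (δ * Real.log d)) ^ ((1 : ℝ) / 4) ≤ τ →
          τ ≤ c₂ * ((n : ℝ) * R / (δ * Real.log d)) ^ ((1 : ℝ) / 4) →
          ∀ (Ω : Type*) [MeasurableSpace Ω] (P : Measure Ω) [IsProbabilityMeasure P]
            (x : Fin n → Ω → EuclideanSpace ℝ (Fin d)),
            iIndepFun x P →
            (∀ i j, IdentDistrib (x i) (x j) P P) →
            (∀ i, ∫ ω, x i ω ∂P = 0) →
            (∀ i, ∀ v : EuclideanSpace ℝ (Fin d), ‖v‖ = 1 →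
              ∫⁻ ω, ENNReal.ofReal ((inner ℝ v (x i ω)) ^ 4) ∂P ≤ ENNReal.ofReal R) →
            ∀ k : Fin n,
              P.real {ω | Real.sqrt (δ * R * d * Real.log d / n) ≤
                  matOpNorm (shrinkageCov τ (fun i => x i ω) - covMatrix P (x k))}
                ≤ (d : ℝ) ^ (1 - C * δ) := by
  refine ⟨2, two_pos, fun c₁ c₂ h₁ h₁₂ => ?_⟩
  have hc₁ : 0 < c₁ := by linarith
  have hc₂ : 0 < c₂ := by linarith
  -- `κ` is the rescaled parameter of the Laplace transform; it satisfies `κ c₂² ≤ 1`, `κ ≤ 1 / 8`.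
  set κ : ℝ := (2 * c₂ ^ 2)⁻¹ with hκ
  have hκ0 : 0 < κ := by positivity
  have hκ8 : κ ≤ 1 / 8 := by
    rw [hκ, one_div]
    exact inv_anti₀ (by norm_num) (by nlinarith)
  refine ⟨κ / 4, by positivity, ?_⟩
  intro n d R δ τ hn hd hR hδ hτ₁ hτ₂ Ω _ P _ x hind hid _ h4 k
  have hn0 : (0 : ℝ) < n := by exact_mod_cast hn
  have hd2 : (2 : ℝ) ≤ d := by exact_mod_cast hd
  have hd0 : (0 : ℝ) < d := by linarith
  have hlog : 0 < Real.log d := Real.log_pos (by linarith)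
  have hsd : 0 < Real.sqrt d := Real.sqrt_pos.2 hd0
  have hB : 0 < (n : ℝ) * R / (δ * Real.log d) := by positivity
  set a : ℝ := ((n : ℝ) * R / (δ * Real.log d)) ^ ((1 : ℝ) / 4) with ha
  have ha0 : 0 < a := Real.rpow_pos_of_pos hB _
  have ha4 : a ^ 4 = (n : ℝ) * R / (δ * Real.log d) := by
    rw [ha, ← Real.rpow_natCast, ← Real.rpow_mul hB.le]; norm_num
  have hna : (n : ℝ) * R / a ^ 4 = δ * Real.log d := by
    rw [ha4]; field_simp
  have hτ0 : 0 < τ := (mul_pos hc₁ ha0).trans_le hτ₁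
  -- In terms of `a` the deviation level is `√d R / a²`.
  have ht : Real.sqrt (δ * R * d * Real.log d / n) = Real.sqrt d * R / a ^ 2 := by
    rw [show δ * R * d * Real.log d / n = (Real.sqrt d * R / a ^ 2) ^ 2 by
      rw [div_pow, mul_pow, Real.sq_sqrt hd0.le, ← pow_mul, ha4]; field_simp]
    exact Real.sqrt_sq (by positivity)
  have hbias : Real.sqrt d * R / τ ^ 2 ≤ 1 / 4 * (Real.sqrt d * R / a ^ 2) := by
    have : 4 * a ^ 2 ≤ τ ^ 2 := by
      have h2a : 2 * a ≤ τ := (mul_le_mul_of_nonneg_right h₁ ha0.le).trans hτ₁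
      nlinarith
    calc Real.sqrt d * R / τ ^ 2 ≤ Real.sqrt d * R / (4 * a ^ 2) := by gcongr
      _ = _ := by field_simp
  set θ : ℝ := κ / (Real.sqrt d * a ^ 2) with hθ
  have hθ0 : 0 < θ := by positivity
  have hθL : θ * (Real.sqrt d * τ ^ 2) ≤ 1 := by
    have h : τ ^ 2 ≤ c₂ ^ 2 * a ^ 2 := by
      rw [← mul_pow]; exact pow_le_pow_left₀ hτ0.le hτ₂ 2
    calc θ * (Real.sqrt d * τ ^ 2) ≤ θ * (Real.sqrt d * (c₂ ^ 2 * a ^ 2)) := by gcongr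
      _ = 1 / 2 := by rw [hθ, hκ]; field_simp
      _ ≤ 1 := by norm_num
  refine two_mul_mul_exp_le_rpow hd2 measureReal_le_one ((measureReal_mono fun ω hω => ?_).trans
    ((measureReal_le_matOpNorm_shrinkageCov_sub_le (t := 3 / 4 * (Real.sqrt d * R / a ^ 2))
      (by omega) (by omega) hR.le hτ0 (by positivity) hind hid h4 hθ0 hθL k).trans ?_))
  · rw [Set.mem_ofPred_eq, ht] at hω
    rw [Set.mem_ofPred_eq]
    linarith
  · have e : n * (θ ^ 2 * (d * R)) - θ * (n * (3 / 4 * (Real.sqrt d * R / a ^ 2))) =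
        (κ ^ 2 - 3 / 4 * κ) * (δ * Real.log d) := by
      rw [← hna, hθ, div_pow, mul_pow, Real.sq_sqrt hd0.le]
      field_simp
    rw [e]
    have h : (κ ^ 2 - 3 / 4 * κ) * (δ * Real.log d) ≤ -(2 * (κ / 4 * δ)) * Real.log d := by
      have : 0 < δ * Real.log d := by positivity
      nlinarith [mul_le_mul_of_nonneg_left hκ8 hκ0.le]
    gcongr
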